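/- There is an absolute constant $C>0$ such that the following holds for all $\varepsilon,\delta\in(0,1)$ and all integers $T,N,S\ge 1$. Consider prediction with expert advice over $T$ rounds with experts $[N]=\{1,\dots,N\}$: in round $t$ a randomized online algorithm picks $J_t\in[N]$, depending on its own previous plays $J_{1:t-1}$ and the previously revealed loss vectors $\ell_1,\dots,\ell_{t-1}\in[0,1]^N$, and then $\ell_t$ is revealed. There exists such an algorithm $\mathcal B$ (which may depend on $\varepsilon,\delta,T,N,S$) with the following two properties. (Privacy) $\mathcal B$ is $(\varepsilon,\delta)$-differentially private against adaptive adversaries: for every set $\mathcal Z$, every adaptive adversary given by functions $\ell_t:[N]\times[N]^{t-1}\times\mathcal Z\to[0,1]$ (generating in round $t$ the loss vector $\ell_t(\cdot,J_{1:t-1},z_t)$), all data sets $z_{1:T},z'_{1:T}\in\mathcal Z^T$ that differ at exactly one time, and every $E\subseteq[N]^T$, $$\Pr_{z}[J_{1:T}\in E]\le e^{\varepsilon}\,\Pr_{z'}[J_{1:T}\in E]+\delta ,$$ where $\Pr_z$ is the law of the plays of $\mathcal B$ interacting with the adversary run on $z_{1:T}$. (Regret) The worst-case expected dynamic regret of $\mathcal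 B$ against oblivious adversaries satisfies $$\sup_{\ell_1,\dots,\ell_T\in[0,1]^N}\mathbb E\Big[\sum_{t=1}^T \ell_t(J_t)-\min_{j_{1:T}}\sum_{t=1}^T\ell_t(j_t)\Big]\le C\left(\sqrt{ST\log(NT)}+\frac{S\,T^{1/3}\log(T/\delta)\log(NT)}{\varepsilon^{2/3}}\right),$$ where the minimum is over all $j_{1:T}\in[N]^T$ with at most $S$ switches, i.e. $\sum_{t=1}^{T-1}\mathbf 1\{j_{t+1}\ne j_t\}\le S$. -/

import Mathlib

/-! Prediction with expert advice over `T` rounds with the `N` experts `Fin N`.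
Rounds are indexed by `Fin T`, so `Fin t` (for `t : Fin T`) indexes the rounds before `t`. -/

namespace PrivateExperts

/-- A loss vector, assigning to every expert a loss in `[0, 1]`. -/
abbrev LossVector (N : ℕ) : Type := Fin N → unitInterval

/-- The experts `j_1, …, j_{t-1}` played before round `t`. -/
def past {N T : ℕ} (j : Fin T → Fin N) (t : Fin T) : Fin t → Fin N :=
  fun s => j (s.castLE t.isLt.le)

/-- A randomized online algorithm with horizon `T` and `N` experts, given by the conditional law
of the expert `J_t` given the loss vectors revealed and the experts played before round `t`. -/
structure OnlineAlgorithm (N T : ℕ) where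
  play : (t : Fin T) → (Fin t → LossVector N) → (Fin t → Fin N) → stdSimplex ℝ (Fin N)

/-- A (general) strategy for choosing the losses: the loss vector of round `t` may depend on the
experts `j_{1:t-1}` that were played before, that is, `f_t(·, j_{1:t-1}) ∈ [0,1]^N`. -/
abbrev LossFunctions (N T : ℕ) : Type := (t : Fin T) → (Fin t → Fin N) → LossVector N

/-- An oblivious adversary: the loss vectors do not depend on the plays. -/
def oblivious {N T : ℕ} (l : Fin T → LossVector N) : LossFunctions N T := fun t _ => l t

namespace OnlineAlgorithm

variable {N T : ℕ}

/-- The probability that the algorithm, playing against `f`, plays exactly `J_{1:T} = j`: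
the product over the rounds of the conditional probabilities. -/
def law (A : OnlineAlgorithm N T) (f : LossFunctions N T) (j : Fin T → Fin N) : ℝ :=
  ∏ t : Fin T,
    (A.play t (fun s => f (s.castLE t.isLt.le) (past j (s.castLE t.isLt.le))) (past j t) :
      Fin N → ℝ) (j t)

/-- The probability of the event `J_{1:T} ∈ E`. -/
def prob (A : OnlineAlgorithm N T) (f : LossFunctions N T) (E : Finset (Fin T → Fin N)) : ℝ :=
  ∑ j ∈ E, A.law f j

/-- The expectation of a function of `J_{1:T}` over the randomness of the algorithm. -/
def expect (A : OnlineAlgorithm N T) (f : LossFunctions N T) (X : (Fin T → Fin N) → ℝ) : ℝ :=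
  ∑ j : Fin T → Fin N, A.law f j * X j

end OnlineAlgorithm

/-- The number of switches `∑_{t=1}^{T-1} 1{c_{t+1} ≠ c_t}` of a sequence of experts. -/
def switches {N T : ℕ} (c : Fin T → Fin N) : ℕ :=
  ∑ t : Fin (T - 1), if c ⟨t + 1, by omega⟩ ≠ c ⟨t, by omega⟩ then 1 else 0

/-- The sequences of `T` experts with at most `S` switches. -/
abbrev Comparator (N T S : ℕ) : Type := {c : Fin T → Fin N // switches c ≤ S}

namespace OnlineAlgorithm

variable {N T : ℕ}

/-- The expected dynamic regret against `f`. The infimum is over a finite set, which is nonempty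
when `0 < N`, so it is a minimum. -/
noncomputable def dynamicRegret (A : OnlineAlgorithm N T) (f : LossFunctions N T) (S : ℕ) : ℝ :=
  A.expect f fun J =>
    (∑ t : Fin T, (f t (past J t) (J t) : ℝ)) -
      ⨅ c : Comparator N T S, ∑ t : Fin T, (f t (past J t) (c.1 t) : ℝ)

/-- The worst-case expected dynamic regret under an oblivious adversary
(the supremum is finite, see `bddAbove_dynamicRegret`). -/
noncomputable def obliviousDynamicRegret (A : OnlineAlgorithm N T) (S : ℕ) : ℝ :=
  ⨆ l : Fin T → LossVector N, A.dynamicRegret (oblivious l) S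

end OnlineAlgorithm

/-- An adaptive adversary with data in `Z`, i.e. functions
`ℓ_t : [N] × [N]^{t-1} × Z → [0,1]`. -/
abbrev AdaptiveAdversary (N T : ℕ) (Z : Type) : Type :=
  (t : Fin T) → (Fin t → Fin N) → Z → LossVector N

/-- The losses `ℓ_t(·, J_{1:t-1}, z_t)` generated by an adversary from the data set `z_{1:T}`. -/
def AdaptiveAdversary.run {N T : ℕ} {Z : Type} (adv : AdaptiveAdversary N T Z) (z : Fin T → Z) :
    LossFunctions N T :=
  fun t h => adv t h (z t)

/-- Two data sets are neighboring if they differ at exactly one time. -/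
def Neighboring {T : ℕ} {Z : Type} (z z' : Fin T → Z) : Prop :=
  ∃ t : Fin T, z t ≠ z' t ∧ ∀ s, s ≠ t → z s = z' s

/-- `(ε, δ)`-differential privacy against adaptive adversaries. -/
def OnlineAlgorithm.IsDP {N T : ℕ} (A : OnlineAlgorithm N T) (ε δ : ℝ) : Prop :=
  ∀ (Z : Type) (adv : AdaptiveAdversary N T Z) (z z' : Fin T → Z), Neighboring z z' →
    ∀ E : Finset (Fin T → Fin N),
      A.prob (adv.run z) E ≤ Real.exp ε * A.prob (adv.run z') E + δ

/-! Well-definedness: `law` is a probability distribution and the supremum is over a bounded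
set. -/

theorem sum_prod_past (N : ℕ) : ∀ (T : ℕ) (g : (t : Fin T) → (Fin t → Fin N) → Fin N → ℝ),
    (∀ t h, ∑ a, g t h a = 1) → ∑ j : Fin T → Fin N, ∏ t, g t (past j t) (j t) = 1 := by
  intro T
  induction T with
  | zero => intro g _; simp
  | succ T ih =>
    intro g hg
    rw [← (Fin.snocEquiv (fun _ : Fin (T + 1) => Fin N)).sum_comp, Fintype.sum_prod_type,
      Finset.sum_comm]
    rw [← ih (fun t h a => g t.castSucc h a) (fun t h => hg t.castSucc h)]
    refine Finset.sum_congr rfl fun j _ => ?_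
    have h1 : ∀ (a : Fin N) (t : Fin T),
        past (Fin.snoc (α := fun _ => Fin N) j a : Fin (T + 1) → Fin N) t.castSucc = past j t := by
      intro a t
      funext s
      have : (Fin.castLE t.castSucc.isLt.le s : Fin (T + 1))
          = (Fin.castLE t.isLt.le s : Fin T).castSucc := rfl
      unfold past
      rw [this, Fin.snoc_castSucc]
    have h2 : ∀ a : Fin N,
        past (Fin.snoc (α := fun _ => Fin N) j a : Fin (T + 1) → Fin N) (Fin.last T) = j := by
      intro a
      funext s
      have : (Fin.castLE (Fin.last T).isLt.le s : Fin (T + 1)) = Fin.castSucc (n := T) s := rfl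
      unfold past
      rw [this, Fin.snoc_castSucc]
    simp only [Fin.snocEquiv, Equiv.coe_fn_mk, Fin.prod_univ_castSucc, Fin.snoc_castSucc,
      Fin.snoc_last, h1, h2]
    rw [← Finset.mul_sum]
    erw [hg (Fin.last T) j]
    rw [mul_one]

namespace OnlineAlgorithm

variable {N T : ℕ}

theorem law_nonneg (A : OnlineAlgorithm N T) (f : LossFunctions N T) (j : Fin T → Fin N) :
    0 ≤ A.law f j :=
  Finset.prod_nonneg fun t _ => (A.play t _ _).2.1 (j t)

theorem sum_law (A : OnlineAlgorithm N T) (f : LossFunctions N T) :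
    ∑ j, A.law f j = 1 := by
  refine sum_prod_past N T (fun t h a => (A.play t (fun s => f (s.castLE t.isLt.le)
    (fun i => h (i.castLE s.isLt.le))) h : Fin N → ℝ) a) ?_
  intro t h
  exact (A.play t _ h).2.2

theorem dynamicRegret_le (A : OnlineAlgorithm N T) (f : LossFunctions N T) (S : ℕ) :
    A.dynamicRegret f S ≤ T := by
  unfold dynamicRegret expect
  calc _ ≤ ∑ j : Fin T → Fin N, A.law f j * (T : ℝ) := by
        refine Finset.sum_le_sum fun j _ => mul_le_mul_of_nonneg_left ?_ (A.law_nonneg f j)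
        have h1 : ∑ t : Fin T, (f t (past j t) (j t) : ℝ) ≤ T := by
          calc _ ≤ ∑ _t : Fin T, (1 : ℝ) := Finset.sum_le_sum fun t _ => (f t (past j t) (j t)).2.2
            _ = T := by simp
        have h2 : 0 ≤ ⨅ c : Comparator N T S, ∑ t : Fin T, (f t (past j t) (c.1 t) : ℝ) :=
          Real.iInf_nonneg fun c => Finset.sum_nonneg fun t _ => (f t (past j t) (c.1 t)).2.1
        linarith
    _ = T := by rw [← Finset.sum_mul, A.sum_law, one_mul]

theorem bddAbove_dynamicRegret (A : OnlineAlgorithm N T) (S : ℕ) :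
    BddAbove (Set.range fun l : Fin T → LossVector N => A.dynamicRegret (oblivious l) S) :=
  ⟨T, by rintro _ ⟨l, rfl⟩; exact A.dynamicRegret_le _ S⟩

end OnlineAlgorithm

end PrivateExperts

/-! The algorithm runs exponential weights over meta-experts, the sequences with at most `S`
switches, of which there are at most `(T * N) ^ (S + 1)`. Sampling afresh from the weights in every
round would leak too much, so the current sample is kept for a long time and the mechanism that
replaces it is hidden.

There are `m` independent hidden slots, each empty or holding a meta-expert that is active or
dormant; the first active slot determines the play. Time is cut into batches of `B` rounds and slots
move only at batch ends. First comes a data-independent shuffle at rate `q`, then a loss stage in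
which a slot survives according to the loss of its meta-expert over the batch. The transition
probabilities are tuned so that, against oblivious losses, the slots stay independent and a nonempty
slot is distributed exactly as the lagged exponential weights, with active and dormant equally
likely (`seqExp_lazy`). The regret is therefore that of lagged exponential weights, plus the
probability, at most `(5 / 8) ^ m` per round, that no slot is active (`lazyAlgorithm_regret_le`).

For privacy, fix the plays. The loss of one round then enters the likelihood in two ways. (1) It
changes the survival probabilities at a single batch end. Active slots reach the empty state only
through dormancy. Falling dormant also happens by the shuffle, with probability of order `q`, and
plays do not tell dormant from empty: the likelihood of the future from a dormant slot is at least
`q` times that from an empty one (`DormantGe`). So each slot contributes a factor `1 + O(η / q)`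
(`slotOp_le_slotOp`, `mass_le_of_survival`). (2) It changes the distribution of fresh meta-experts
in all later batches. Here the `n`-th moment of the likelihood ratio is bounded, and Markov's
inequality produces `δ`. One fresh draw costs a factor `1 + O(n ^ 2 * η ^ 2)`, because the
first-order term cancels (`sum_mul_ratio_pow_le`). A potential that charges draws to the events that
empty a slot shows that draws occur at rate only `O(η * B + q ^ 2)` per slot and batch, not `q`
(`slotOp_slotPotential_le`).

With `q` about `m * η / ε`, `B` about `q ^ 2 / η`, `m` about `Λ = log (2 * T / δ)` and `n` about `Λ
/ ε`, part (2) requires `T * η ^ 3 * Λ ^ 3 ≲ ε ^ 2`. Hence `η` is at most of order `1 / (X * Λ)`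
with `X = T ^ (1 / 3) / ε ^ (2 / 3)`, and the regret term `log (card) / η` gives the second term of
the bound. -/

namespace PrivateExperts

/-! ### Hidden slots

A slot is empty (`none`) or holds a meta-expert `c`, either active (`some (c, true)`) or dormant
(`some (c, false)`). Kernels on slots are represented by the operators that send a function `u` to
the conditional expectation of `u` at the next state. -/

/-- The state of a slot. -/
abbrev Slot (M : Type) : Type := Option (M × Bool)

/-- The probability that a dormant slot survives, when an active one survives with
probability `x`. -/
noncomputable def keep (x : ℝ) : ℝ := x / (2 - x)

/-- The expectation of `u` at a fresh slot, drawn from `f` and active with probability `1 / 2`. -/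
noncomputable def fresh {M : Type} [Fintype M] (f : M → ℝ) (u : Slot M → ℝ) : ℝ :=
  ∑ c, f c * ((u (some (c, true)) + u (some (c, false))) / 2)

/-- The loss stage: an active slot with `c` becomes dormant with probability `1 - g c`, then a
dormant slot is emptied with probability `1 - keep (g c)`. -/
noncomputable def lossOp {M : Type} (g : M → ℝ) : (Slot M → ℝ) →ₗ[ℝ] (Slot M → ℝ) where
  toFun u
    | none => u none
    | some (c, false) => keep (g c) * u (some (c, false)) + (1 - keep (g c)) * u none
    | some (c, true) => g c * u (some (c, true)) +
        (1 - g c) * (keep (g c) * u (some (c, false)) + (1 - keep (g c)) * u none)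
  map_add' u v := by
    ext s
    rcases s with _ | ⟨c, _ | _⟩ <;> simp only [Pi.add_apply] <;> ring
  map_smul' a u := by
    ext s
    rcases s with _ | ⟨c, _ | _⟩ <;> simp only [Pi.smul_apply, smul_eq_mul, RingHom.id_apply] <;> ring

/-- The data-independent stage: active slots fall dormant; dormant slots become active or are
replaced by a fresh one; empty slots are replaced by a fresh one. -/
noncomputable def ringOp {M : Type} [Fintype M] (p r : ℝ) (f : M → ℝ) :
    (Slot M → ℝ) →ₗ[ℝ] (Slot M → ℝ) where
  toFun u
    | none => (1 - p) * u none + p * fresh f u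
    | some (c, false) => (1 - p) * u (some (c, false)) + p * (1 - r) * u (some (c, true)) +
        p * r * fresh f u
    | some (c, true) => (1 - p * (1 - r / 2)) * u (some (c, true)) +
        p * (1 - r / 2) * u (some (c, false))
  map_add' u v := by
    have h : fresh f (u + v) = fresh f u + fresh f v := by
      simp only [fresh, Pi.add_apply, ← Finset.sum_add_distrib]
      exact Finset.sum_congr rfl fun c _ => by ring
    ext s
    rcases s with _ | ⟨c, _ | _⟩ <;> simp only [Pi.add_apply, h] <;> ring
  map_smul' a u := by
    have h : fresh f (a • u) = a * fresh f u := by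
      simp only [fresh, Pi.smul_apply, smul_eq_mul, Finset.mul_sum]
      exact Finset.sum_congr rfl fun c _ => by ring
    ext s
    rcases s with _ | ⟨c, _ | _⟩ <;>
      simp only [Pi.smul_apply, smul_eq_mul, RingHom.id_apply, h] <;> ring

/-- One step of a slot. -/
noncomputable def slotOp {M : Type} [Fintype M] (p r : ℝ) (f g : M → ℝ) :
    (Slot M → ℝ) →ₗ[ℝ] (Slot M → ℝ) :=
  ringOp p r f ∘ₗ lossOp g

section slot

variable {M : Type}

@[simp] theorem lossOp_none (g : M → ℝ) (u : Slot M → ℝ) : lossOp g u none = u none := rfl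

theorem lossOp_dormant (g : M → ℝ) (u : Slot M → ℝ) (c : M) :
    lossOp g u (some (c, false)) =
      keep (g c) * u (some (c, false)) + (1 - keep (g c)) * u none := rfl

theorem lossOp_active (g : M → ℝ) (u : Slot M → ℝ) (c : M) :
    lossOp g u (some (c, true)) =
      g c * u (some (c, true)) + (1 - g c) * lossOp g u (some (c, false)) := rfl

theorem keep_nonneg {x : ℝ} (h0 : 0 ≤ x) (h1 : x ≤ 1) : 0 ≤ keep x :=
  div_nonneg h0 (by linarith)

theorem keep_le_one {x : ℝ} (h1 : x ≤ 1) : keep x ≤ 1 :=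
  div_le_one_of_le₀ (by linarith) (by linarith)

theorem one_sub_keep_le {x : ℝ} (h1 : x ≤ 1) : 1 - keep x ≤ 2 * (1 - x) := by
  have h : (0 : ℝ) < 2 - x := by linarith
  rw [keep, one_sub_div h.ne', div_le_iff₀ h]
  nlinarith

theorem abs_keep_sub_keep_le {x y : ℝ} (hx : x ≤ 1) (hy : y ≤ 1) :
    |keep x - keep y| ≤ 2 * |x - y| := by
  have h1 : (1 : ℝ) ≤ 2 - x := by linarith
  have h2 : (1 : ℝ) ≤ 2 - y := by linarith
  have : keep x - keep y = 2 * (x - y) / ((2 - x) * (2 - y)) := by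
    rw [keep, keep, div_sub_div _ _ (by linarith) (by linarith)]
    ring
  rw [this, abs_div, abs_mul, abs_of_pos (show (0 : ℝ) < 2 by norm_num),
    abs_of_pos (show (0 : ℝ) < (2 - x) * (2 - y) by positivity)]
  exact div_le_self (by positivity) (by nlinarith)

/-- A positive operator. -/
def IsPos {X : Type} (k : (X → ℝ) →ₗ[ℝ] (X → ℝ)) : Prop :=
  ∀ u : X → ℝ, (∀ x, 0 ≤ u x) → ∀ x, 0 ≤ k u x

theorem IsPos.mono {X : Type} {k : (X → ℝ) →ₗ[ℝ] (X → ℝ)} (hk : IsPos k) {u v : X → ℝ}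
    (huv : ∀ x, u x ≤ v x) (x : X) : k u x ≤ k v x := by
  have := hk (v - u) (fun x => sub_nonneg.2 (huv x)) x
  rw [map_sub, Pi.sub_apply] at this
  linarith

theorem IsPos.comp {X : Type} {k l : (X → ℝ) →ₗ[ℝ] (X → ℝ)} (hk : IsPos k) (hl : IsPos l) :
    IsPos (k ∘ₗ l) := fun u hu => hk _ (hl u hu)

theorem isPos_lossOp {g : M → ℝ} (h0 : ∀ c, 0 ≤ g c) (h1 : ∀ c, g c ≤ 1) : IsPos (lossOp g) := by
  intro u hu s
  have hD : ∀ c, 0 ≤ lossOp g u (some (c, false)) := fun c => by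
    rw [lossOp_dormant]
    exact add_nonneg (mul_nonneg (keep_nonneg (h0 c) (h1 c)) (hu _))
      (mul_nonneg (sub_nonneg.2 (keep_le_one (h1 c))) (hu _))
  rcases s with _ | ⟨c, _ | _⟩
  · exact hu _
  · exact hD c
  · rw [lossOp_active]
    exact add_nonneg (mul_nonneg (h0 c) (hu _)) (mul_nonneg (sub_nonneg.2 (h1 c)) (hD c))

variable [Fintype M]

theorem ringOp_none (p r : ℝ) (f : M → ℝ) (u : Slot M → ℝ) :
    ringOp p r f u none = (1 - p) * u none + p * fresh f u := rfl

theorem ringOp_dormant (p r : ℝ) (f : M → ℝ) (u : Slot M → ℝ) (c : M) :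
    ringOp p r f u (some (c, false)) =
      (1 - p) * u (some (c, false)) + p * (1 - r) * u (some (c, true)) + p * r * fresh f u := rfl

theorem ringOp_active (p r : ℝ) (f : M → ℝ) (u : Slot M → ℝ) (c : M) :
    ringOp p r f u (some (c, true)) =
      (1 - p * (1 - r / 2)) * u (some (c, true)) + p * (1 - r / 2) * u (some (c, false)) := rfl

theorem fresh_nonneg {f : M → ℝ} (hf : ∀ c, 0 ≤ f c) {u : Slot M → ℝ} (hu : ∀ s, 0 ≤ u s) :
    0 ≤ fresh f u :=
  Finset.sum_nonneg fun c _ => mul_nonneg (hf c) (div_nonneg (add_nonneg (hu _) (hu _)) two_pos.le)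

theorem isPos_ringOp {p r : ℝ} (hp0 : 0 ≤ p) (hp1 : p ≤ 1) (hr0 : 0 ≤ r) (hr1 : r ≤ 1)
    {f : M → ℝ} (hf : ∀ c, 0 ≤ f c) : IsPos (ringOp p r f) := by
  intro u hu s
  have hF := fresh_nonneg hf hu
  have h2 : 0 ≤ 1 - r / 2 := by linarith
  have h3 : 0 ≤ 1 - p * (1 - r / 2) := by nlinarith
  rcases s with _ | ⟨c, _ | _⟩
  · rw [ringOp_none]
    exact add_nonneg (mul_nonneg (by linarith) (hu _)) (mul_nonneg hp0 hF)
  · rw [ringOp_dormant]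
    exact add_nonneg (add_nonneg (mul_nonneg (by linarith) (hu _))
      (mul_nonneg (mul_nonneg hp0 (by linarith)) (hu _))) (mul_nonneg (mul_nonneg hp0 hr0) hF)
  · rw [ringOp_active]
    exact add_nonneg (mul_nonneg h3 (hu _)) (mul_nonneg (mul_nonneg hp0 h2) (hu _))

theorem isPos_slotOp {p r : ℝ} (hp0 : 0 ≤ p) (hp1 : p ≤ 1) (hr0 : 0 ≤ r) (hr1 : r ≤ 1)
    {f g : M → ℝ} (hf : ∀ c, 0 ≤ f c) (h0 : ∀ c, 0 ≤ g c) (h1 : ∀ c, g c ≤ 1) :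
    IsPos (slotOp p r f g) :=
  (isPos_ringOp hp0 hp1 hr0 hr1 hf).comp (isPos_lossOp h0 h1)

theorem slotOp_one (p r : ℝ) {f : M → ℝ} (g : M → ℝ) (hf : ∑ c, f c = 1) :
    slotOp p r f g (fun _ => 1) = fun _ => 1 := by
  have h1 : lossOp g (fun _ => (1 : ℝ)) = fun _ => 1 := by
    ext s
    rcases s with _ | ⟨c, _ | _⟩
    · rfl
    · rw [lossOp_dormant]; ring
    · rw [lossOp_active, lossOp_dormant]; ring
  have h2 : fresh f (fun _ => (1 : ℝ)) = 1 := by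
    simp [fresh, hf]
  ext s
  rw [slotOp, LinearMap.comp_apply, h1]
  rcases s with _ | ⟨c, _ | _⟩
  · rw [ringOp_none, h2]; ring
  · rw [ringOp_dormant, h2]; ring
  · rw [ringOp_active]; ring

/-- At a state where the future cannot distinguish dormant from empty slots, a dormant slot is at
least `r` times as likely as an empty one. -/
theorem slotOp_dormant_ge {p r : ℝ} (hp0 : 0 ≤ p) (hp1 : p ≤ 1) (hr1 : r ≤ 1)
    {f g : M → ℝ} (h0 : ∀ c, 0 ≤ g c) (h1 : ∀ c, g c ≤ 1)
    {u : Slot M → ℝ} (hu : ∀ s, 0 ≤ u s) (hr : ∀ c, r * u none ≤ u (some (c, false))) (c : M) :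
    r * slotOp p r f g u none ≤ slotOp p r f g u (some (c, false)) := by
  have hL := isPos_lossOp h0 h1 u hu
  have hD : r * u none ≤ lossOp g u (some (c, false)) := by
    rw [lossOp_dormant]
    have := mul_le_mul_of_nonneg_left (hr c) (keep_nonneg (h0 c) (h1 c))
    have h3 : r * u none ≤ u none := mul_le_of_le_one_left (hu _) hr1
    have := mul_le_mul_of_nonneg_left h3 (sub_nonneg.2 (keep_le_one (h1 c)))
    linarith
  simp only [slotOp, LinearMap.comp_apply]
  -- Both kinds of slot stay put with probability `1 - p`; a dormant one is refreshed with
  -- probability `p * r`, exactly `r` times the probability `p` for an empty one.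
  rw [ringOp_none, ringOp_dormant, lossOp_none]
  have h4 := mul_le_mul_of_nonneg_left hD (sub_nonneg.2 hp1)
  have h5 := mul_nonneg (mul_nonneg hp0 (sub_nonneg.2 hr1)) (hL (some (c, true)))
  linarith

/-- Changing the loss of one round changes likelihoods by a bounded factor. -/
theorem slotOp_le_slotOp {q e : ℝ} (hq0 : 0 < q) (hq1 : q ≤ 1) (he : 0 ≤ e)
    {f g g' : M → ℝ} (hf : ∀ c, 0 ≤ f c)
    (h1 : ∀ c, g c ≤ 1) (h0' : ∀ c, 2 / 3 ≤ g' c) (h1' : ∀ c, g' c ≤ 1)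
    (hg : ∀ c, |g c - g' c| ≤ e)
    {u : Slot M → ℝ} (hu : ∀ s, 0 ≤ u s) (hr : ∀ c, q * u none ≤ u (some (c, false)))
    (s : Slot M) :
    slotOp q q f g u s ≤ (1 + 4 * e / q) * (1 + 2 * e / q) * slotOp q q f g' u s := by
  set a := 1 + 4 * e / q with ha
  set b := 1 + 2 * e / q with hb
  have heq : e ≤ e / q := le_div_self he hq0 hq1
  have hb' : 1 + 2 * e ≤ b := by rw [hb, mul_div_assoc]; linarith
  have ha1 : 1 ≤ a := by rw [ha]; linarith [show 0 ≤ 4 * e / q by positivity]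
  have hb1 : 1 ≤ b := by linarith
  have hL' := isPos_lossOp (fun c => by linarith [h0' c]) h1' u hu
  have hk' : ∀ c, 1 / 2 ≤ keep (g' c) := fun c => by
    rw [keep, le_div_iff₀ (by linarith [h1' c])]
    linarith [h0' c]
  have hD : ∀ c, lossOp g u (some (c, false)) ≤ a * lossOp g' u (some (c, false)) := by
    intro c
    have hk : |keep (g c) - keep (g' c)| ≤ 2 * e :=
      (abs_keep_sub_keep_le (h1 c) (h1' c)).trans (by linarith [hg c])
    have h3 := abs_le.1 hk
    have hW : u (some (c, false)) / 2 ≤ lossOp g' u (some (c, false)) := by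
      rw [lossOp_dormant]
      have := mul_nonneg (sub_nonneg.2 (keep_le_one (h1' c))) (hu none)
      have := mul_le_mul_of_nonneg_right (hk' c) (hu (some (c, false)))
      linarith
    -- At most `2 * e` of probability moves between dormant and empty, and by `hr` the future from
    -- empty is at most `1 / q` times as likely as from dormant.
    have hmax : (keep (g c) - keep (g' c)) * (u (some (c, false)) - u none)
        ≤ 2 * e * (u (some (c, false)) / q) := by
      have h5 : u none ≤ u (some (c, false)) / q := by
        rw [le_div_iff₀ hq0]; linarith [hr c]
      have h6 : u (some (c, false)) ≤ u (some (c, false)) / q := le_div_self (hu _) hq0 hq1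
      have h7 : |u (some (c, false)) - u none| ≤ u (some (c, false)) / q := by
        rw [abs_le]; constructor <;> linarith [hu none, hu (some (c, false))]
      calc _ ≤ |(keep (g c) - keep (g' c)) * (u (some (c, false)) - u none)| := le_abs_self _
        _ = |keep (g c) - keep (g' c)| * |u (some (c, false)) - u none| := abs_mul _ _
        _ ≤ _ := mul_le_mul hk h7 (abs_nonneg _) (by linarith)
    have h8 : lossOp g u (some (c, false)) = lossOp g' u (some (c, false)) +
        (keep (g c) - keep (g' c)) * (u (some (c, false)) - u none) := by
      rw [lossOp_dormant, lossOp_dormant]; ring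
    have h9 : 2 * e * (u (some (c, false)) / q) = 4 * e / q * (u (some (c, false)) / 2) := by
      field_simp; ring
    have h10 := mul_le_mul_of_nonneg_left hW (show 0 ≤ 4 * e / q by positivity)
    rw [h8, ha]
    linarith
  -- An active slot may fall dormant with up to `e` more probability. The term `e * lossOp g' u
  -- (some (c, false))` cannot be compared with the active value; it is absorbed below, once the
  -- shuffle has put weight on dormancy.
  have hA : ∀ c, lossOp g u (some (c, true)) ≤
      a * ((1 + 2 * e) * lossOp g' u (some (c, true)) + e * lossOp g' u (some (c, false))) := by
    intro c
    have h3 := abs_le.1 (hg c)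
    have h4 : g c ≤ (1 + 2 * e) * g' c := by nlinarith [h0' c]
    have h5 : 1 - g c ≤ 1 - g' c + e := by linarith
    rw [lossOp_active, lossOp_active g']
    set d := lossOp g u (some (c, false))
    set d' := lossOp g' u (some (c, false))
    have hd' : 0 ≤ d' := hL' _
    have hu1 := hu (some (c, true))
    calc _ ≤ (1 + 2 * e) * g' c * u (some (c, true)) + (1 - g c) * (a * d') :=
          add_le_add (mul_le_mul_of_nonneg_right h4 hu1)
            (mul_le_mul_of_nonneg_left (hD c) (by linarith [h1 c]))
      _ ≤ a * ((1 + 2 * e) * g' c * u (some (c, true))) + (1 - g' c + e) * (a * d') := by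
          refine add_le_add (le_mul_of_one_le_left ?_ ha1) (mul_le_mul_of_nonneg_right h5 ?_)
          · have := h0' c; positivity
          · positivity
      _ ≤ _ := by
          have h6 : 0 ≤ a * (2 * e * ((1 - g' c) * d')) := by
            have := sub_nonneg.2 (h1' c); positivity
          linarith
  set LA' := fun c => lossOp g' u (some (c, true)) with hLA'
  set LD' := fun c => lossOp g' u (some (c, false)) with hLD'
  have hab : 0 ≤ a * b := by positivity
  have hF : fresh f (lossOp g u) ≤ a * b * fresh f (lossOp g' u) := by
    rw [fresh, fresh, Finset.mul_sum]
    refine Finset.sum_le_sum fun c _ => ?_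
    have h3 := hA c
    have h4 := hD c
    have h5 : lossOp g u (some (c, true)) + lossOp g u (some (c, false)) ≤
        a * b * (LA' c + LD' c) := by
      have h6 : (1 + 2 * e) * LA' c ≤ b * LA' c := mul_le_mul_of_nonneg_right hb' (hL' _)
      have h7 : (1 + e) * LD' c ≤ b * LD' c :=
        mul_le_mul_of_nonneg_right (by linarith) (hL' _)
      have h8 := mul_le_mul_of_nonneg_left (add_le_add h6 h7) (by linarith : (0 : ℝ) ≤ a)
      simp only [hLA', hLD'] at *
      linarith
    have := mul_le_mul_of_nonneg_left h5 (hf c)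
    simp only [hLA', hLD'] at this
    linarith
  simp only [slotOp, LinearMap.comp_apply]
  rcases s with _ | ⟨c, _ | _⟩
  · rw [ringOp_none, ringOp_none, lossOp_none, lossOp_none]
    have h3 : u none ≤ a * b * u none := le_mul_of_one_le_left (hu _) (by nlinarith)
    have h4 := mul_le_mul_of_nonneg_left h3 (sub_nonneg.2 hq1)
    have h5 := mul_le_mul_of_nonneg_left hF hq0.le
    linarith
  · rw [ringOp_dormant, ringOp_dormant]
    have h3 := mul_le_mul_of_nonneg_left (hD c) (sub_nonneg.2 hq1)
    have h4 := mul_le_mul_of_nonneg_left (hA c) (mul_nonneg hq0.le (sub_nonneg.2 hq1))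
    have h5 := mul_le_mul_of_nonneg_left hF (mul_nonneg hq0.le hq0.le)
    have hx := hL' (some (c, true))
    have hy := hL' (some (c, false))
    set X := lossOp g' u (some (c, true))
    set Y := lossOp g' u (some (c, false))
    have h6 : (1 - q) * (a * Y) + q * (1 - q) * (a * ((1 + 2 * e) * X + e * Y)) ≤
        a * b * ((1 - q) * Y + q * (1 - q) * X) := by
      have h7 : (1 + q * e) * Y ≤ b * Y := mul_le_mul_of_nonneg_right (by nlinarith) hy
      have h8 : (1 + 2 * e) * X ≤ b * X := mul_le_mul_of_nonneg_right hb' hx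
      have h9 : 0 ≤ a * (1 - q) := mul_nonneg (by linarith) (by linarith)
      have h10 := mul_le_mul_of_nonneg_left h7 h9
      have h11 := mul_le_mul_of_nonneg_left h8 (mul_nonneg h9 hq0.le)
      linarith
    linarith
  · rw [ringOp_active, ringOp_active]
    have hpa : q / 2 ≤ q * (1 - q / 2) := by nlinarith
    have hpa1 : q * (1 - q / 2) ≤ 1 := by nlinarith
    set P := q * (1 - q / 2)
    have hP : 0 < P := by linarith
    have h3 := mul_le_mul_of_nonneg_left (hD c) hP.le
    have h4 := mul_le_mul_of_nonneg_left (hA c) (sub_nonneg.2 hpa1)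
    have hx := hL' (some (c, true))
    have hy := hL' (some (c, false))
    set X := lossOp g' u (some (c, true))
    set Y := lossOp g' u (some (c, false))
    -- The shuffle makes an active slot dormant with probability `P ≥ q / 2`, so an excess of `e` is
    -- at most a fraction `2 * e / q` of `P`.
    have h7 : ((1 - P) * e + P) * Y ≤ b * P * Y := by
      refine mul_le_mul_of_nonneg_right ?_ hy
      have : e ≤ 2 * e / q * P := by
        calc e = 2 * e / q * (q / 2) := by field_simp
          _ ≤ _ := mul_le_mul_of_nonneg_left hpa (by positivity)
      rw [hb]
      nlinarith
    have h8 : (1 + 2 * e) * X ≤ b * X := mul_le_mul_of_nonneg_right hb' hx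
    have h9 := mul_le_mul_of_nonneg_left h7 (by linarith : (0 : ℝ) ≤ a)
    have h10 := mul_le_mul_of_nonneg_left h8
      (mul_nonneg (by linarith : (0 : ℝ) ≤ a) (sub_nonneg.2 hpa1))
    linarith

end slot

/-! ### Several slots -/

section sweep

variable {M : Type} {m : ℕ}

/-- The action of a slot operator on slot `i`. -/
def slotAct (k : (Slot M → ℝ) →ₗ[ℝ] (Slot M → ℝ)) (i : Fin m) :
    ((Fin m → Slot M) → ℝ) →ₗ[ℝ] ((Fin m → Slot M) → ℝ) where
  toFun W h := k (fun s => W (Function.update h i s)) (h i)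
  map_add' U W := by
    ext h
    exact congrFun (map_add k (fun s => U (Function.update h i s))
      (fun s => W (Function.update h i s))) (h i)
  map_smul' a W := by
    ext h
    exact congrFun (map_smul k a (fun s => W (Function.update h i s))) (h i)

theorem slotAct_apply (k : (Slot M → ℝ) →ₗ[ℝ] (Slot M → ℝ)) (i : Fin m)
    (W : (Fin m → Slot M) → ℝ) (h : Fin m → Slot M) :
    slotAct k i W h = k (fun s => W (Function.update h i s)) (h i) := rfl

theorem slotAct_update_self (k : (Slot M → ℝ) →ₗ[ℝ] (Slot M → ℝ)) (i : Fin m)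
    (W : (Fin m → Slot M) → ℝ) (h : Fin m → Slot M) (s : Slot M) :
    slotAct k i W (Function.update h i s) = k (fun s => W (Function.update h i s)) s := by
  simp [slotAct_apply]

theorem slotAct_update_of_ne (k : (Slot M → ℝ) →ₗ[ℝ] (Slot M → ℝ)) {i i' : Fin m} (hi : i' ≠ i)
    (W : (Fin m → Slot M) → ℝ) (h : Fin m → Slot M) (s : Slot M) :
    slotAct k i W (Function.update h i' s) =
      k (fun s' => W (Function.update (Function.update h i s') i' s)) (h i) := by
  simp only [slotAct_apply, Function.update_of_ne hi.symm]
  simp only [Function.update_comm hi]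

/-- The slot operator `k` acts on all slots in a list. -/
def sweep (k : (Slot M → ℝ) →ₗ[ℝ] (Slot M → ℝ)) :
    List (Fin m) → ((Fin m → Slot M) → ℝ) →ₗ[ℝ] ((Fin m → Slot M) → ℝ)
  | [] => LinearMap.id
  | i :: is => slotAct k i ∘ₗ sweep k is

theorem isPos_slotAct {k : (Slot M → ℝ) →ₗ[ℝ] (Slot M → ℝ)} (hk : IsPos k) (i : Fin m) :
    IsPos (slotAct k i) := fun _ hW _ => hk _ (fun _ => hW _) _

theorem isPos_sweep {k : (Slot M → ℝ) →ₗ[ℝ] (Slot M → ℝ)} (hk : IsPos k) (is : List (Fin m)) :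
    IsPos (sweep k is) := by
  induction is with
  | nil => exact fun u hu => hu
  | cons i is ih => exact (isPos_slotAct hk i).comp ih

theorem sweep_one {k : (Slot M → ℝ) →ₗ[ℝ] (Slot M → ℝ)} (hk : k (fun _ => 1) = fun _ => 1)
    (is : List (Fin m)) : sweep k is (fun _ => 1) = fun _ => 1 := by
  induction is with
  | nil => rfl
  | cons i is ih =>
    ext h
    rw [sweep, LinearMap.comp_apply, ih, slotAct_apply, hk]

/-- Nonnegative functions whose value at a dormant slot is at least `r` times the value at an
empty slot. -/
def DormantGe (r : ℝ) (W : (Fin m → Slot M) → ℝ) : Prop :=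
  (∀ h, 0 ≤ W h) ∧ ∀ h i c,
    r * W (Function.update h i none) ≤ W (Function.update h i (some (c, false)))

/-- A slot operator that preserves `DormantGe r` in its slot. -/
def PreservesDormantGe (r : ℝ) (k : (Slot M → ℝ) →ₗ[ℝ] (Slot M → ℝ)) : Prop :=
  ∀ u : Slot M → ℝ, (∀ s, 0 ≤ u s) → (∀ c, r * u none ≤ u (some (c, false))) →
    ∀ c, r * k u none ≤ k u (some (c, false))

theorem DormantGe.slotAct {r : ℝ} {k : (Slot M → ℝ) →ₗ[ℝ] (Slot M → ℝ)} (hk : IsPos k)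
    (hkr : PreservesDormantGe r k) (i : Fin m) {W : (Fin m → Slot M) → ℝ}
    (hW : DormantGe r W) : DormantGe r (slotAct k i W) := by
  refine ⟨isPos_slotAct hk i W hW.1, fun h i' c => ?_⟩
  by_cases hi : i' = i
  · subst hi
    rw [slotAct_update_self, slotAct_update_self]
    exact hkr _ (fun _ => hW.1 _) (fun c => hW.2 h i' c) c
  · rw [slotAct_update_of_ne k hi, slotAct_update_of_ne k hi]
    have h1 := hk.mono (u := r • fun s' => W (Function.update (Function.update h i s') i' none))
      (fun s' => hW.2 (Function.update h i s') i' c) (h i)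
    rwa [map_smul] at h1

theorem DormantGe.sweep {r : ℝ} {k : (Slot M → ℝ) →ₗ[ℝ] (Slot M → ℝ)} (hk : IsPos k)
    (hkr : PreservesDormantGe r k) (is : List (Fin m)) {W : (Fin m → Slot M) → ℝ}
    (hW : DormantGe r W) : DormantGe r (sweep k is W) := by
  induction is with
  | nil => exact hW
  | cons i is ih => exact ih.slotAct hk hkr i

/-- Slots move one after the other and what remains of the future keeps `DormantGe`, so each slot
costs one factor `a`. -/
theorem sweep_le_sweep {r a : ℝ} (ha : 0 ≤ a) {k k' : (Slot M → ℝ) →ₗ[ℝ] (Slot M → ℝ)}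
    (hk : IsPos k) (hk' : IsPos k') (hkr : PreservesDormantGe r k')
    (hkk : ∀ u : Slot M → ℝ, (∀ s, 0 ≤ u s) → (∀ c, r * u none ≤ u (some (c, false))) →
      ∀ s, k u s ≤ a * k' u s)
    (is : List (Fin m)) {W : (Fin m → Slot M) → ℝ} (hW : DormantGe r W) (h : Fin m → Slot M) :
    sweep k is W h ≤ a ^ is.length * sweep k' is W h := by
  induction is generalizing h with
  | nil => simp [sweep]
  | cons i is ih =>
    have hS := hW.sweep hk' hkr is
    have h1 := (isPos_slotAct hk i).mono (v := a ^ is.length • sweep k' is W) ih h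
    rw [map_smul, Pi.smul_apply, smul_eq_mul] at h1
    have h2 := hkk (fun s => sweep k' is W (Function.update h i s)) (fun _ => hS.1 _)
      (fun c => hS.2 h i c) (h i)
    calc _ ≤ _ := h1
      _ ≤ a ^ is.length * (a * slotAct k' i (sweep k' is W) h) :=
        mul_le_mul_of_nonneg_left h2 (pow_nonneg ha _)
      _ = _ := by rw [List.length_cons, pow_succ, mul_assoc]; rfl

/-! ### Moments of likelihood ratios -/

/-- `R` bounds the `n`-th moment of the likelihood ratio of `k` and `k'`. -/
def MomentDom {X : Type} (n : ℕ) (k k' R : (X → ℝ) →ₗ[ℝ] (X → ℝ)) : Prop :=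
  ∀ u v w : X → ℝ, (∀ s : ℝ, 0 < s → ∀ x, u x ≤ s * v x + s⁻¹ ^ n * w x) →
    ∀ s : ℝ, 0 < s → ∀ x, k u x ≤ s * k' v x + s⁻¹ ^ n * R w x

/-- Optimising over `s`, the inequality `u ≤ s * v + s⁻¹ ^ n * w` (with `v, w ≥ 0`) says `u ^ (n +
1) ≤ C_n * v ^ n * w`, and `w = u * (u / v) ^ n` satisfies it. For fixed `s` it is linear in `(u, v,
w)`, so positive operators preserve it and no convexity argument is needed. -/
theorem MomentDom.of_isPos {X : Type} (n : ℕ) {k : (X → ℝ) →ₗ[ℝ] (X → ℝ)} (hk : IsPos k) :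
    MomentDom n k k k := by
  intro u v w huvw s hs x
  have := hk.mono (v := s • v + s⁻¹ ^ n • w) (huvw s hs) x
  rwa [map_add, map_smul, map_smul] at this

theorem MomentDom.comp {X : Type} {n : ℕ} {k k' R l l' Q : (X → ℝ) →ₗ[ℝ] (X → ℝ)}
    (hk : MomentDom n k k' R) (hl : MomentDom n l l' Q) :
    MomentDom n (k ∘ₗ l) (k' ∘ₗ l') (R ∘ₗ Q) :=
  fun u v w huvw => hk _ _ _ (hl u v w huvw)

theorem MomentDom.sweep {n : ℕ} {k k' R : (Slot M → ℝ) →ₗ[ℝ] (Slot M → ℝ)}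
    (hk : MomentDom n k k' R) (is : List (Fin m)) :
    MomentDom n (sweep k is) (sweep k' is) (sweep R is) := by
  induction is with
  | nil => exact fun u v w huvw => huvw
  | cons i is ih =>
    exact MomentDom.comp (fun u v w huvw s hs h => hk _ _ _ (fun s hs _ => huvw s hs _) s hs _) ih

/-- The two kernels differ only in the fresh draw, so the moment kernel is the same kernel with the
fresh weights multiplied by the `n`-th power of the likelihood ratio. These weights no longer sum to
`1`. -/
theorem MomentDom.slotOp [Fintype M] (n : ℕ) {p r : ℝ} (hp0 : 0 ≤ p) (hp1 : p ≤ 1) (hr0 : 0 ≤ r)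
    (hr1 : r ≤ 1) {f f' g : M → ℝ} (hf : ∀ c, 0 < f c) (hf' : ∀ c, 0 < f' c) (h0 : ∀ c, 0 ≤ g c)
    (h1 : ∀ c, g c ≤ 1) :
    MomentDom n (slotOp p r f g) (slotOp p r f' g)
      (slotOp p r (fun c => f c * (f c / f' c) ^ n) g) := by
  refine MomentDom.comp ?_ (.of_isPos n (isPos_lossOp h0 h1))
  intro u v w huvw s hs x
  have hF : fresh f u ≤ s * fresh f' v + s⁻¹ ^ n * fresh (fun c => f c * (f c / f' c) ^ n) w := by
    simp only [fresh, Finset.mul_sum, ← Finset.sum_add_distrib]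
    refine Finset.sum_le_sum fun c _ => ?_
    have hc := hf c
    have hc' := hf' c
    have key : ∀ x, f c * u x ≤ s * (f' c * v x) + s⁻¹ ^ n * (f c * (f c / f' c) ^ n * w x) := by
      intro x
      -- The parameter is rescaled by the ratio `f' c / f c`, separately for each `c`; this turns
      -- `f` into `f'` in front of `v` and produces the power of the ratio in front of `w`.
      have h2 := mul_le_mul_of_nonneg_left (huvw (s * (f' c / f c)) (by positivity) x) hc.le
      have e1 : f c * (s * (f' c / f c) * v x) = s * (f' c * v x) := by field_simp
      have e2 : (s * (f' c / f c))⁻¹ = s⁻¹ * (f c / f' c) := by field_simp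
      rw [e2, mul_pow, mul_add, e1] at h2
      linarith
    have h3 := key (some (c, true))
    have h4 := key (some (c, false))
    linarith
  have h2 : 0 ≤ 1 - r / 2 := by linarith
  have h3 : 0 ≤ 1 - p * (1 - r / 2) := by nlinarith
  have h4 : 0 ≤ 1 - p := by linarith
  have h5 : 0 ≤ p * (1 - r) := mul_nonneg hp0 (by linarith)
  rcases x with _ | ⟨c, _ | _⟩
  · rw [ringOp_none, ringOp_none, ringOp_none]
    have h6 := mul_le_mul_of_nonneg_left (huvw s hs none) h4
    have h7 := mul_le_mul_of_nonneg_left hF hp0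
    linarith
  · rw [ringOp_dormant, ringOp_dormant, ringOp_dormant]
    have h6 := mul_le_mul_of_nonneg_left (huvw s hs (some (c, false))) h4
    have h7 := mul_le_mul_of_nonneg_left hF (mul_nonneg hp0 hr0)
    have h8 := mul_le_mul_of_nonneg_left (huvw s hs (some (c, true))) h5
    linarith
  · rw [ringOp_active, ringOp_active, ringOp_active]
    have h6 := mul_le_mul_of_nonneg_left (huvw s hs (some (c, true))) h3
    have h7 := mul_le_mul_of_nonneg_left (huvw s hs (some (c, false))) (mul_nonneg hp0 h2)
    linarith

/-! ### Amortised cost of fresh draws -/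

/-- The potential of a slot: `x` if it is empty, `1` otherwise. -/
def slotPotential (x : ℝ) (s : Slot M) : ℝ := s.elim x fun _ => 1

/-- The product of the potentials of the slots. -/
def potential (x : ℝ) (h : Fin m → Slot M) : ℝ := ∏ i, slotPotential x (h i)

theorem one_le_slotPotential {x : ℝ} (hx : 1 ≤ x) (s : Slot M) : 1 ≤ slotPotential x s := by
  cases s
  · exact hx
  · exact le_rfl

theorem one_le_potential {x : ℝ} (hx : 1 ≤ x) (h : Fin m → Slot M) : 1 ≤ potential x h :=
  Finset.prod_induction _ (1 ≤ ·) (fun _ _ => one_le_mul_of_one_le_of_one_le) le_rfl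
    fun i _ => one_le_slotPotential hx (h i)

/-- An empty slot has already paid `x` for its next draw, so refilling it is free. The potential
grows only when a slot is emptied, with probability at most `2 * b`, or when a dormant slot is
replaced, with probability `p * r`. -/
theorem slotOp_slotPotential_le [Fintype M] {p r b x : ℝ} (hp0 : 0 ≤ p) (hp1 : p ≤ 1)
    (hr0 : 0 ≤ r) (hr1 : r ≤ 1) (hb0 : 0 ≤ b) (hx : 1 ≤ x) {f g : M → ℝ} (hf : ∀ c, 0 ≤ f c)
    (hfx : ∑ c, f c ≤ x) (h0 : ∀ c, 0 ≤ g c) (h1 : ∀ c, g c ≤ 1) (hb : ∀ c, 1 - g c ≤ b)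
    (s : Slot M) :
    slotOp p r f g (slotPotential x) s ≤ Real.exp ((2 * b + p * r) * (x - 1)) *
      slotPotential x s := by
  have hpr : 0 ≤ p * r := mul_nonneg hp0 hr0
  have hring : ∀ s, ringOp p r f (slotPotential x) s ≤ (1 + p * r * (x - 1)) * slotPotential x s := by
    have hF : fresh f (slotPotential x) ≤ x := by
      simpa [fresh, slotPotential] using hfx
    have hF1 := mul_le_mul_of_nonneg_left hF hp0
    have hF2 := mul_le_mul_of_nonneg_left hF hpr
    have h3 : 0 ≤ p * r * (x - 1) := mul_nonneg hpr (by linarith)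
    intro s
    rcases s with _ | ⟨c, _ | _⟩
    · rw [ringOp_none]
      simp only [slotPotential, Option.elim_none] at *
      have := mul_nonneg h3 (by linarith : 0 ≤ x)
      linarith
    · rw [ringOp_dormant]
      simp only [slotPotential, Option.elim_some] at *
      linarith
    · rw [ringOp_active]
      simp only [slotPotential, Option.elim_some] at *
      linarith
  have hloss : ∀ s, lossOp g (slotPotential x) s ≤ (1 + 2 * b * (x - 1)) * slotPotential x s := by
    have h3 : 0 ≤ 2 * b * (x - 1) := mul_nonneg (by linarith) (by linarith)
    have hD : ∀ c, lossOp g (slotPotential x) (some (c, false)) ≤ 1 + 2 * b * (x - 1) := by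
      intro c
      rw [lossOp_dormant]
      simp only [slotPotential, Option.elim_some, Option.elim_none]
      have := mul_le_mul_of_nonneg_right ((one_sub_keep_le (h1 c)).trans
        (mul_le_mul_of_nonneg_left (hb c) two_pos.le)) (by linarith : 0 ≤ x - 1)
      linarith
    intro s
    rcases s with _ | ⟨c, _ | _⟩
    · rw [lossOp_none]
      simp only [slotPotential, Option.elim_none]
      have := mul_nonneg h3 (by linarith : 0 ≤ x)
      linarith
    · simpa [slotPotential] using hD c
    · rw [lossOp_active]
      have := mul_le_mul_of_nonneg_left (hD c) (sub_nonneg.2 (h1 c))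
      have := mul_nonneg (h0 c) h3
      simp only [slotPotential, Option.elim_some] at *
      linarith
  have h2 := (isPos_ringOp hp0 hp1 hr0 hr1 hf).mono
    (v := (1 + 2 * b * (x - 1)) • slotPotential x) hloss s
  rw [map_smul, Pi.smul_apply, smul_eq_mul] at h2
  have h3 : 0 ≤ 2 * b * (x - 1) := mul_nonneg (by linarith) (by linarith)
  have h4 : 0 ≤ p * r * (x - 1) := mul_nonneg hpr (by linarith)
  have h5 : 0 ≤ slotPotential x s := by linarith [one_le_slotPotential hx s]
  calc _ ≤ _ := h2
    _ ≤ (1 + 2 * b * (x - 1)) * ((1 + p * r * (x - 1)) * slotPotential x s) :=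
      mul_le_mul_of_nonneg_left (hring s) (by linarith)
    _ = (1 + 2 * b * (x - 1)) * (1 + p * r * (x - 1)) * slotPotential x s := by ring
    _ ≤ Real.exp (2 * b * (x - 1)) * Real.exp (p * r * (x - 1)) * slotPotential x s := by
      refine mul_le_mul_of_nonneg_right (mul_le_mul ?_ ?_ (by linarith) (Real.exp_pos _).le) h5
      · linarith [Real.add_one_le_exp (2 * b * (x - 1))]
      · linarith [Real.add_one_le_exp (p * r * (x - 1))]
    _ = _ := by rw [← Real.exp_add]; ring_nf

theorem sweep_potential_le {x a : ℝ} (ha : 0 ≤ a) {R : (Slot M → ℝ) →ₗ[ℝ] (Slot M → ℝ)}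
    (hx : 1 ≤ x) (hR : IsPos R) (hRx : ∀ s, R (slotPotential x) s ≤ a * slotPotential x s)
    (is : List (Fin m)) (h : Fin m → Slot M) :
    sweep R is (potential x) h ≤ a ^ is.length * potential x h := by
  induction is generalizing h with
  | nil => simp [sweep]
  | cons i is ih =>
    have h1 := (isPos_slotAct hR i).mono (v := a ^ is.length • potential x) ih h
    rw [map_smul, Pi.smul_apply, smul_eq_mul] at h1
    have h2 : (fun s => potential x (Function.update h i s)) =
        (∏ j ∈ Finset.univ.erase i, slotPotential x (h j)) • slotPotential x := by
      ext s
      rw [potential, ← Finset.mul_prod_erase _ _ (Finset.mem_univ i), Function.update_self,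
        Pi.smul_apply, smul_eq_mul, mul_comm]
      congr 1
      exact Finset.prod_congr rfl fun j hj => by
        rw [Function.update_of_ne (Finset.ne_of_mem_erase hj)]
    have h3 : slotAct R i (potential x) h ≤ a * potential x h := by
      rw [slotAct_apply, h2, map_smul, Pi.smul_apply, smul_eq_mul, potential,
        ← Finset.mul_prod_erase _ _ (Finset.mem_univ i)]
      have := mul_le_mul_of_nonneg_left (hRx (h i))
        (Finset.prod_nonneg fun j _ => zero_le_one.trans (one_le_slotPotential hx (h j)) :
          0 ≤ ∏ j ∈ Finset.univ.erase i, slotPotential x (h j))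
      linarith
    calc _ ≤ _ := h1
      _ ≤ a ^ is.length * (a * potential x h) := mul_le_mul_of_nonneg_left h3 (pow_nonneg ha _)
      _ = _ := by rw [List.length_cons, pow_succ, mul_assoc]

end sweep

/-! ### Algorithms with a hidden Markov state -/

section seqExp

variable {H : Type}

/-- The expectation functional after `n` steps with the operators `k 0, …, k (n - 1)`. -/
def seqExp (init : (H → ℝ) →ₗ[ℝ] ℝ) (k : ℕ → (H → ℝ) →ₗ[ℝ] (H → ℝ)) : ℕ → (H → ℝ) →ₗ[ℝ] ℝ
  | 0 => init
  | n + 1 => seqExp init k n ∘ₗ k n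

theorem seqExp_succ (init : (H → ℝ) →ₗ[ℝ] ℝ) (k : ℕ → (H → ℝ) →ₗ[ℝ] (H → ℝ)) (n : ℕ)
    (W : H → ℝ) : seqExp init k (n + 1) W = seqExp init k n (k n W) := rfl

theorem seqExp_congr (init : (H → ℝ) →ₗ[ℝ] ℝ) {k k' : ℕ → (H → ℝ) →ₗ[ℝ] (H → ℝ)} {n : ℕ}
    (h : ∀ s < n, k s = k' s) : seqExp init k n = seqExp init k' n := by
  induction n with
  | zero => rfl
  | succ n ih => rw [seqExp, seqExp, ih fun s hs => h s (by omega), h n (by omega)]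

variable {init : (H → ℝ) →ₗ[ℝ] ℝ}

theorem seqExp_nonneg (hi : ∀ W : H → ℝ, (∀ h, 0 ≤ W h) → 0 ≤ init W)
    {k : ℕ → (H → ℝ) →ₗ[ℝ] (H → ℝ)} (hk : ∀ n, IsPos (k n)) (n : ℕ) {W : H → ℝ}
    (hW : ∀ h, 0 ≤ W h) : 0 ≤ seqExp init k n W := by
  induction n generalizing W with
  | zero => exact hi W hW
  | succ n ih => exact ih (hk n W hW)

theorem seqExp_mono (hi : ∀ W : H → ℝ, (∀ h, 0 ≤ W h) → 0 ≤ init W)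
    {k : ℕ → (H → ℝ) →ₗ[ℝ] (H → ℝ)} (hk : ∀ n, IsPos (k n)) (n : ℕ) {U W : H → ℝ}
    (hW : ∀ h, U h ≤ W h) : seqExp init k n U ≤ seqExp init k n W := by
  have := seqExp_nonneg hi hk n (W := W - U) fun h => sub_nonneg.2 (hW h)
  rw [map_sub] at this
  linarith

/-- If two sequences of operators differ at one time only, and there by a bounded factor, then
their expectations differ by at most this factor. -/
theorem seqExp_le_of_eq_except (hi : ∀ W : H → ℝ, (∀ h, 0 ≤ W h) → 0 ≤ init W)
    {k k' : ℕ → (H → ℝ) →ₗ[ℝ] (H → ℝ)} (hk : ∀ n, IsPos (k n)) {b : ℕ}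
    (hkk : ∀ n, n ≠ b → k n = k' n) {C : (H → ℝ) → Prop} (hC : ∀ n W, C W → C (k' n W)) {a : ℝ}
    (ha : 1 ≤ a) (hb : ∀ W, C W → ∀ h, k b W h ≤ a * k' b W h)
    (hC0 : ∀ W, C W → ∀ h, 0 ≤ W h) (n : ℕ) {W : H → ℝ} (hW : C W) :
    seqExp init k n W ≤ a * seqExp init k' n W := by
  induction n generalizing W with
  | zero => exact le_mul_of_one_le_left (hi W (hC0 W hW)) ha
  | succ n ih =>
    rw [seqExp_succ, seqExp_succ]
    by_cases hn : n = b
    · subst hn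
      rw [← seqExp_congr init (fun s hs => hkk s (by omega))]
      calc _ ≤ seqExp init k n (a • k' n W) := seqExp_mono hi hk n (hb W hW)
        _ = _ := by rw [map_smul, smul_eq_mul]
    · rw [hkk n hn]
      exact ih (hC n W hW)

theorem seqExp_momentDom (hi : ∀ W : H → ℝ, (∀ h, 0 ≤ W h) → 0 ≤ init W)
    {k k' R : ℕ → (H → ℝ) →ₗ[ℝ] (H → ℝ)} {p : ℕ} (hk : ∀ n, MomentDom p (k n) (k' n) (R n))
    (n : ℕ) {u v w : H → ℝ} (huvw : ∀ s : ℝ, 0 < s → ∀ x, u x ≤ s * v x + s⁻¹ ^ p * w x)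
    {s : ℝ} (hs : 0 < s) :
    seqExp init k n u ≤ s * seqExp init k' n v + s⁻¹ ^ p * seqExp init R n w := by
  induction n generalizing u v w with
  | zero =>
    have := hi (s • v + s⁻¹ ^ p • w - u) (fun h => sub_nonneg.2 (huvw s hs h))
    rw [map_sub, map_add, map_smul, map_smul, smul_eq_mul, smul_eq_mul] at this
    simp only [seqExp]
    linarith
  | succ n ih => exact ih (hk n u v w huvw)

/-- Multiplication with the indicator of the event that `a` is played. -/
def obs {N : ℕ} (vis : H → Fin N) (a : Fin N) : (H → ℝ) →ₗ[ℝ] (H → ℝ) where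
  toFun W h := if vis h = a then W h else 0
  map_add' U W := by
    ext h
    by_cases hv : vis h = a <;> simp [hv]
  map_smul' b W := by
    ext h
    by_cases hv : vis h = a <;> simp [hv]

theorem obs_apply {N : ℕ} (vis : H → Fin N) (a : Fin N) (W : H → ℝ) (h : H) :
    obs vis a W h = if vis h = a then W h else 0 := rfl

theorem isPos_obs {N : ℕ} (vis : H → Fin N) (a : Fin N) : IsPos (obs vis a) := by
  intro W hW h
  rw [obs_apply]
  split_ifs
  exacts [hW h, le_rfl]

theorem sum_obs {N : ℕ} (vis : H → Fin N) (W : Fin N → H → ℝ) :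
    ∑ a, obs vis a (W a) = fun h => W (vis h) h := by
  ext h
  simp [obs_apply]

/-- A sequence, continued by a constant. -/
def extend {α : Type} (d : α) {n : ℕ} (x : Fin n → α) (s : ℕ) : α :=
  if h : s < n then x ⟨s, h⟩ else d

theorem extend_of_lt {α : Type} (d : α) {n : ℕ} (x : Fin n → α) {s : ℕ} (h : s < n) :
    extend d x s = x ⟨s, h⟩ := dif_pos h

theorem extend_snoc_of_lt {α : Type} (d : α) {n : ℕ} (x : Fin n → α) (a : α) {s : ℕ} (h : s < n) :
    extend d (Fin.snoc (α := fun _ => α) x a : Fin (n + 1) → α) s = extend d x s := by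
  rw [extend_of_lt d _ h, extend_of_lt d _ (by omega : s < n + 1)]
  exact Fin.snoc_castSucc (α := fun _ => α) a x ⟨s, h⟩

theorem extend_snoc_self {α : Type} (d : α) {n : ℕ} (x : Fin n → α) (a : α) :
    extend d (Fin.snoc (α := fun _ => α) x a : Fin (n + 1) → α) n = a := by
  rw [extend_of_lt d _ (by omega : n < n + 1)]
  exact Fin.snoc_last (α := fun _ => α) a x

theorem sum_snoc {α : Type} [Fintype α] {n : ℕ} (F : (Fin (n + 1) → α) → ℝ) :
    ∑ J, F J = ∑ J : Fin n → α, ∑ a, F (Fin.snoc (α := fun _ => α) J a) := by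
  rw [← (Fin.snocEquiv (fun _ : Fin (n + 1) => α)).sum_comp, Fintype.sum_prod_type,
    Finset.sum_comm]
  rfl

/-- Sums over all sequences of plays of expectations along these sequences. -/
theorem sum_seqExp_le {N : ℕ} (d : Fin N) (hi : ∀ W : H → ℝ, (∀ h, 0 ≤ W h) → 0 ≤ init W)
    {vis : ℕ → H → Fin N} {R : (ℕ → Fin N) → ℕ → (H → ℝ) →ₗ[ℝ] (H → ℝ)}
    (hR : ∀ j n, IsPos (R j n)) (hRj : ∀ j j' n, (∀ s ≤ n, j s = j' s) → R j n = R j' n)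
    {P : H → ℝ} {a : ℕ → ℝ} (hRa : ∀ j n h, R j n P h ≤ a n * P h) (ha : ∀ n, 0 ≤ a n)
    (n : ℕ) :
    ∑ J : Fin n → Fin N, seqExp init (fun s => obs (vis s) (extend d J s) ∘ₗ R (extend d J) s) n P ≤
      (∏ s ∈ Finset.range n, a s) * init P := by
  induction n with
  | zero => simp [seqExp]
  | succ n ih =>
    rw [sum_snoc]
    have h1 : ∀ J : Fin n → Fin N, ∑ b, seqExp init (fun s => obs (vis s)
        (extend d (Fin.snoc (α := fun _ => Fin N) J b : Fin (n + 1) → Fin N) s) ∘ₗ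
          R (extend d (Fin.snoc (α := fun _ => Fin N) J b : Fin (n + 1) → Fin N)) s) (n + 1) P ≤
        a n * seqExp init (fun s => obs (vis s) (extend d J s) ∘ₗ R (extend d J) s) n P := by
      intro J
      have h2 : ∀ b, seqExp init (fun s => obs (vis s)
          (extend d (Fin.snoc (α := fun _ => Fin N) J b : Fin (n + 1) → Fin N) s) ∘ₗ
          R (extend d (Fin.snoc (α := fun _ => Fin N) J b : Fin (n + 1) → Fin N)) s) (n + 1) P =
          seqExp init (fun s => obs (vis s) (extend d J s) ∘ₗ R (extend d J) s) n
            (obs (vis n) b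
              (R (extend d (Fin.snoc (α := fun _ => Fin N) J b : Fin (n + 1) → Fin N)) n P)) := by
        intro b
        rw [seqExp_succ, LinearMap.comp_apply, extend_snoc_self]
        refine congrArg (fun E : (H → ℝ) →ₗ[ℝ] ℝ => E _) (seqExp_congr init fun s hs => ?_)
        rw [extend_snoc_of_lt d J b hs, hRj _ (extend d J) s fun u hu =>
          extend_snoc_of_lt d J b (by omega)]
      simp only [h2]
      -- Summing over the last play `b` selects at each hidden state `h` the operator that belongs
      -- to the play visible at `h`; the bound `hRa` is uniform in the plays, so it applies to this
      -- mixture.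
      rw [← map_sum, sum_obs, ← smul_eq_mul, ← map_smul]
      exact seqExp_mono hi (fun s => (isPos_obs _ _).comp (hR _ _)) n fun h => hRa _ n h
    calc _ ≤ _ := Finset.sum_le_sum fun J _ => h1 J
      _ ≤ a n * ((∏ s ∈ Finset.range n, a s) * init P) := by
        rw [← Finset.mul_sum]
        exact mul_le_mul_of_nonneg_left ih (ha n)
      _ = _ := by rw [Finset.prod_range_succ]; ring

/-- The joint law of the hidden state and one play, when the operators do not depend on the
plays. -/
theorem sum_seqExp_eq {N : ℕ} (d : Fin N) (vis : ℕ → H → Fin N)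
    (k : ℕ → (H → ℝ) →ₗ[ℝ] (H → ℝ)) (n : ℕ) (W : H → ℝ) :
    ∑ J : Fin n → Fin N, seqExp init (fun s => obs (vis s) (extend d J s) ∘ₗ k s) n W =
      seqExp init k n W := by
  induction n generalizing W with
  | zero => simp [seqExp]
  | succ n ih =>
    rw [sum_snoc, seqExp_succ, ← ih]
    refine Finset.sum_congr rfl fun J _ => ?_
    have h2 : ∀ b, seqExp init (fun s => obs (vis s)
          (extend d (Fin.snoc (α := fun _ => Fin N) J b : Fin (n + 1) → Fin N) s) ∘ₗ k s)
          (n + 1) W =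
          seqExp init (fun s => obs (vis s) (extend d J s) ∘ₗ k s) n (obs (vis n) b (k n W)) := by
      intro b
      rw [seqExp_succ, LinearMap.comp_apply, extend_snoc_self]
      refine congrArg (fun E : (H → ℝ) →ₗ[ℝ] ℝ => E _) (seqExp_congr init fun s hs => ?_)
      rw [extend_snoc_of_lt d J b hs]
    simp only [h2]
    rw [← map_sum, sum_obs]

theorem sum_seqExp_mul_eq {N : ℕ} (d : Fin N) (vis : ℕ → H → Fin N)
    {k : ℕ → (H → ℝ) →ₗ[ℝ] (H → ℝ)} (hk : ∀ n, k n (fun _ => 1) = fun _ => 1) (n : ℕ)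
    (φ : Fin N → ℝ) {t : ℕ} (ht : t < n) :
    ∑ J : Fin n → Fin N, seqExp init (fun s => obs (vis s) (extend d J s) ∘ₗ k s) n (fun _ => 1) *
      φ (extend d J t) = seqExp init k t (fun h => φ (vis t h)) := by
  induction n with
  | zero => omega
  | succ n ih =>
    rw [sum_snoc]
    have h2 : ∀ (J : Fin n → Fin N) b, seqExp init (fun s => obs (vis s)
          (extend d (Fin.snoc (α := fun _ => Fin N) J b : Fin (n + 1) → Fin N) s) ∘ₗ k s)
          (n + 1) (fun _ => 1) =
          seqExp init (fun s => obs (vis s) (extend d J s) ∘ₗ k s) n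
            (obs (vis n) b (fun _ => 1)) := by
      intro J b
      rw [seqExp_succ, LinearMap.comp_apply, extend_snoc_self, hk]
      refine congrArg (fun E : (H → ℝ) →ₗ[ℝ] ℝ => E _) (seqExp_congr init fun s hs => ?_)
      rw [extend_snoc_of_lt d J b hs]
    simp only [h2]
    rcases Nat.lt_succ_iff_lt_or_eq.1 ht with ht | rfl
    · rw [← ih ht]
      refine Finset.sum_congr rfl fun J _ => ?_
      simp only [extend_snoc_of_lt d J _ ht]
      rw [← Finset.sum_mul, ← map_sum, sum_obs]
    · rw [← sum_seqExp_eq d vis k t]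
      refine Finset.sum_congr rfl fun J _ => ?_
      simp only [extend_snoc_self]
      rw [← sum_obs (vis t) (fun a _ => φ a), map_sum]
      refine Finset.sum_congr rfl fun a _ => ?_
      rw [mul_comm, ← smul_eq_mul, ← map_smul, ← map_smul]
      congr 2
      ext h
      simp

end seqExp

/-! ### From hidden states to online algorithms -/

/-- An algorithm that plays a function of a hidden Markov state. The transition operator of each
step depends on the losses revealed so far. -/
structure HiddenAlgorithm (H : Type) (N : ℕ) where
  default : Fin N
  init : (H → ℝ) →ₗ[ℝ] ℝ
  vis : ℕ → H → Fin N
  op : (ℕ → LossVector N) → ℕ → (H → ℝ) →ₗ[ℝ] (H → ℝ)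
  init_nonneg : ∀ W : H → ℝ, (∀ h, 0 ≤ W h) → 0 ≤ init W
  init_one : init (fun _ => 1) = 1
  isPos_op : ∀ l t, IsPos (op l t)
  op_one : ∀ l t, op l t (fun _ => 1) = fun _ => 1
  op_congr : ∀ l l' t, (∀ s ≤ t, l s = l' s) → op l t = op l' t

namespace HiddenAlgorithm

variable {H : Type} {N : ℕ} (A : HiddenAlgorithm H N)

/-- The probability that the plays of the first `n` rounds are `j`. -/
def mass (l : ℕ → LossVector N) (j : ℕ → Fin N) (n : ℕ) : ℝ :=
  seqExp A.init (fun t => obs (A.vis t) (j t) ∘ₗ A.op l t) n (fun _ => 1)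

theorem mass_zero (l : ℕ → LossVector N) (j : ℕ → Fin N) : A.mass l j 0 = 1 := A.init_one

theorem mass_nonneg (l : ℕ → LossVector N) (j : ℕ → Fin N) (n : ℕ) : 0 ≤ A.mass l j n :=
  seqExp_nonneg A.init_nonneg (fun t => (isPos_obs _ _).comp (A.isPos_op l t)) n
    fun _ => zero_le_one

theorem mass_succ (l : ℕ → LossVector N) (j : ℕ → Fin N) (n : ℕ) :
    A.mass l j (n + 1) = seqExp A.init (fun t => obs (A.vis t) (j t) ∘ₗ A.op l t) n
      (obs (A.vis n) (j n) (fun _ => 1)) := by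
  rw [mass, seqExp_succ, LinearMap.comp_apply, A.op_one]

/-- The final transition preserves the constant `1` and drops out, so the loss of the last of the
`n` rounds is irrelevant. This makes `condLaw` computable from the losses revealed before its round.
-/
theorem mass_congr {l l' : ℕ → LossVector N} {j j' : ℕ → Fin N} {n : ℕ}
    (hl : ∀ s, s + 1 < n → l s = l' s) (hj : ∀ s < n, j s = j' s) :
    A.mass l j n = A.mass l' j' n := by
  cases n with
  | zero => rw [mass_zero, mass_zero]
  | succ n =>
    rw [mass_succ, mass_succ, hj n (by omega)]
    refine congrArg (fun E : (H → ℝ) →ₗ[ℝ] ℝ => E _) (seqExp_congr _ fun s hs => ?_)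
    rw [hj s (by omega), A.op_congr l l' s fun u hu => hl u (by omega)]

theorem sum_mass_update (l : ℕ → LossVector N) (j : ℕ → Fin N) (n : ℕ) :
    ∑ a, A.mass l (Function.update j n a) (n + 1) = A.mass l j n := by
  have h : ∀ a, A.mass l (Function.update j n a) (n + 1) =
      seqExp A.init (fun t => obs (A.vis t) (j t) ∘ₗ A.op l t) n
        (obs (A.vis n) a (fun _ => 1)) := by
    intro a
    rw [mass_succ, Function.update_self]
    refine congrArg (fun E : (H → ℝ) →ₗ[ℝ] ℝ => E _) (seqExp_congr _ fun s hs => ?_)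
    rw [Function.update_of_ne hs.ne]
  simp only [h]
  rw [← map_sum, sum_obs]
  rfl

/-- The conditional law of the play of round `n`. -/
noncomputable def condLaw (l : ℕ → LossVector N) (j : ℕ → Fin N) (n : ℕ) : Fin N → ℝ :=
  if A.mass l j n = 0 then Pi.single A.default 1
  else fun a => A.mass l (Function.update j n a) (n + 1) / A.mass l j n

theorem condLaw_mem (l : ℕ → LossVector N) (j : ℕ → Fin N) (n : ℕ) :
    A.condLaw l j n ∈ stdSimplex ℝ (Fin N) := by
  rw [condLaw]
  split_ifs with h
  · exact single_mem_stdSimplex ℝ A.default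
  · exact ⟨fun a => div_nonneg (A.mass_nonneg _ _ _) (A.mass_nonneg _ _ _), by
      rw [← Finset.sum_div, sum_mass_update, div_self h]⟩

theorem condLaw_mul_mass (l : ℕ → LossVector N) (j : ℕ → Fin N) (n : ℕ) (a : Fin N) :
    A.condLaw l j n a * A.mass l j n = A.mass l (Function.update j n a) (n + 1) := by
  rw [condLaw]
  split_ifs with h
  -- A null history has only null continuations, so the arbitrary value of `condLaw` there does no
  -- harm.
  · have h1 : ∀ a ∈ Finset.univ, A.mass l (Function.update j n a) (n + 1) = 0 :=
      (Finset.sum_eq_zero_iff_of_nonneg fun a _ => A.mass_nonneg _ _ _).1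
        ((A.sum_mass_update l j n).trans h)
    rw [h, mul_zero, h1 a (Finset.mem_univ a)]
  · exact div_mul_cancel₀ _ h

/-- The online algorithm. -/
noncomputable def toOnline (T : ℕ) : OnlineAlgorithm N T where
  play t x h := ⟨A.condLaw (extend (fun _ => 0) x) (extend A.default h) t, A.condLaw_mem _ _ _⟩

theorem prod_eq_of_mul_eq {T : ℕ} (q : Fin T → ℝ) (a : ℕ → ℝ) (ha : a 0 = 1)
    (h : ∀ t : Fin T, q t * a t = a (t + 1)) : ∏ t, q t = a T := by
  induction T with
  | zero => simp [ha]
  | succ T ih =>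
    rw [Fin.prod_univ_castSucc, ih (fun t => q t.castSucc) fun t => h t.castSucc, mul_comm]
    exact h (Fin.last T)

theorem law_toOnline {T : ℕ} (f : LossFunctions N T) (j : Fin T → Fin N) :
    (A.toOnline T).law f j =
      A.mass (extend (fun _ => 0) fun t => f t (past j t)) (extend A.default j) T := by
  refine prod_eq_of_mul_eq _ (fun n => A.mass (extend (fun _ => 0) fun t => f t (past j t))
    (extend A.default j) n) (A.mass_zero _ _) fun t => ?_
  have hl : ∀ s < (t : ℕ), (extend (fun _ => 0) (fun s : Fin t => f (s.castLE t.isLt.le)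
      (past j (s.castLE t.isLt.le))) s : LossVector N) =
        extend (fun _ => 0) (fun t => f t (past j t)) s := by
    intro s hs
    rw [extend_of_lt _ _ hs, extend_of_lt _ _ (hs.trans t.isLt)]
    rfl
  have hj : ∀ s < (t : ℕ), extend A.default (past j t) s = extend A.default j s := by
    intro s hs
    rw [extend_of_lt _ _ hs, extend_of_lt _ _ (hs.trans t.isLt)]
    rfl
  have h1 := A.condLaw_mul_mass (extend (fun _ => 0) fun s : Fin t => f (s.castLE t.isLt.le)
      (past j (s.castLE t.isLt.le))) (extend A.default (past j t)) t (j t)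
  rw [A.mass_congr (fun s hs => hl s (by omega)) hj,
    A.mass_congr (fun s hs => hl s (by omega)) (j' := extend A.default j) ?_] at h1
  · exact h1
  · intro s hs
    rcases Nat.lt_succ_iff_lt_or_eq.1 hs with hs | rfl
    · rw [Function.update_of_ne hs.ne, hj s hs]
    · rw [Function.update_self, extend_of_lt _ _ t.isLt]

end HiddenAlgorithm

/-! ### Exponential weights -/

section weights

variable {M : Type}

/-- The cumulative losses up to the beginning of the current batch of `B` rounds. -/
def lag (B : ℕ) (w : ℕ → M → ℝ) (t : ℕ) (c : M) : ℝ := ∑ s ∈ Finset.range (B * (t / B)), w s c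

/-- Exponential weights for the cumulative losses `L`. -/
noncomputable def expWeights [Fintype M] (η : ℝ) (L : M → ℝ) (c : M) : ℝ :=
  Real.exp (-η * L c) / ∑ c', Real.exp (-η * L c')

theorem lag_congr {B : ℕ} {w w' : ℕ → M → ℝ} {t : ℕ} (h : ∀ s < t, w s = w' s) :
    lag B w t = lag B w' t := by
  ext c
  refine Finset.sum_congr rfl fun s hs => ?_
  rw [h s (by have := Finset.mem_range.1 hs; have := Nat.mul_div_le t B; omega)]

theorem lag_succ_of_not_dvd {B : ℕ} (w : ℕ → M → ℝ) {t : ℕ} (h : ¬ B ∣ t + 1) :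
    lag B w (t + 1) = lag B w t := by
  ext c
  rw [lag, lag, Nat.succ_div_of_not_dvd h]

theorem lag_le_lag_succ {B : ℕ} {w : ℕ → M → ℝ} (hw : ∀ t c, 0 ≤ w t c) (t : ℕ) (c : M) :
    lag B w t c ≤ lag B w (t + 1) c :=
  Finset.sum_le_sum_of_subset_of_nonneg
    (Finset.range_mono (Nat.mul_le_mul_left _ (Nat.div_le_div_right t.le_succ))) fun s _ _ => hw s c

theorem lag_succ_le {B : ℕ} {w : ℕ → M → ℝ} (hw : ∀ t c, w t c ≤ 1) (t : ℕ) (c : M) :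
    lag B w (t + 1) c ≤ lag B w t c + B := by
  by_cases h : B ∣ t + 1
  · rw [lag, lag, Nat.succ_div_of_dvd h, mul_add, mul_one, Finset.sum_range_add]
    have : ∑ s ∈ Finset.range B, w (B * (t / B) + s) c ≤ ∑ _s ∈ Finset.range B, (1 : ℝ) :=
      Finset.sum_le_sum fun s _ => hw _ c
    simpa using this
  · rw [lag_succ_of_not_dvd w h]
    linarith [(Nat.cast_nonneg B : (0 : ℝ) ≤ B)]

/-- The last round of the batch of round `τ`. -/
def batchEnd (B τ : ℕ) : ℕ := B * (τ / B + 1) - 1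

theorem dvd_batchEnd {B : ℕ} (hB : 0 < B) (τ : ℕ) : B ∣ batchEnd B τ + 1 := by
  have : 0 < B * (τ / B + 1) := Nat.mul_pos hB (Nat.succ_pos _)
  rw [batchEnd, Nat.sub_add_cancel this]
  exact Dvd.intro _ rfl

theorem lag_sub_lag {B : ℕ} {w w' : ℕ → M → ℝ} {τ : ℕ} (h : ∀ s, s ≠ τ → w s = w' s) (t : ℕ)
    (c : M) : lag B w t c - lag B w' t c = if τ < B * (t / B) then w τ c - w' τ c else 0 := by
  rw [lag, lag, ← Finset.sum_sub_distrib]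
  have h1 : ∀ s, w s c - w' s c = if s = τ then w s c - w' s c else 0 := fun s => by
    split_ifs with hs
    · rfl
    · rw [h s hs, sub_self]
  rw [Finset.sum_congr rfl fun s _ => h1 s, Finset.sum_ite_eq']
  simp only [Finset.mem_range]

theorem abs_lag_sub_lag_le {B : ℕ} {w w' : ℕ → M → ℝ} {τ : ℕ} (h : ∀ s, s ≠ τ → w s = w' s)
    (h1 : ∀ c, |w τ c - w' τ c| ≤ 1) (t : ℕ) (c : M) : |lag B w t c - lag B w' t c| ≤ 1 := by
  rw [lag_sub_lag h]
  split_ifs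
  · exact h1 c
  · simp

/-- The loss of round `τ` enters the lagged sums in one jump, at the end of its batch, and cancels
from every other increment. Hence neighbouring data change survival probabilities at one time only.
-/
theorem lag_diff_eq {B : ℕ} (hB : 0 < B) {w w' : ℕ → M → ℝ} {τ : ℕ} (h : ∀ s, s ≠ τ → w s = w' s)
    {t : ℕ} (ht : t ≠ batchEnd B τ) (c : M) :
    lag B w (t + 1) c - lag B w t c = lag B w' (t + 1) c - lag B w' t c := by
  have h1 := lag_sub_lag (B := B) h t c
  have h2 := lag_sub_lag (B := B) h (t + 1) c
  have h3 : ∀ k, τ < B * k ↔ τ / B < k := fun k => by rw [Nat.div_lt_iff_lt_mul hB, mul_comm]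
  have h4 : (τ < B * ((t + 1) / B)) ↔ τ < B * (t / B) := by
    rw [h3, h3]
    by_cases hd : B ∣ t + 1
    · rw [Nat.succ_div_of_dvd hd]
      refine ⟨fun h5 => ?_, fun h5 => h5.trans (Nat.lt_succ_self _)⟩
      rcases Nat.lt_succ_iff_lt_or_eq.1 h5 with h5 | h5
      · exact h5
      · exfalso
        apply ht
        have := Nat.div_mul_cancel hd
        rw [Nat.succ_div_of_dvd hd, ← h5, mul_comm] at this
        rw [batchEnd, this]
        rfl
    · rw [Nat.succ_div_of_not_dvd hd]
  rw [if_congr h4 rfl rfl] at h2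
  linarith

theorem abs_lag_diff_le {B : ℕ} {w w' : ℕ → M → ℝ} {τ : ℕ}
    (h : ∀ s, s ≠ τ → w s = w' s) (h1 : ∀ c, |w τ c - w' τ c| ≤ 1) (t : ℕ) (c : M) :
    |(lag B w (t + 1) c - lag B w t c) - (lag B w' (t + 1) c - lag B w' t c)| ≤ 1 := by
  have h2 := lag_sub_lag (B := B) h t c
  have h3 := lag_sub_lag (B := B) h (t + 1) c
  have h4 : (lag B w (t + 1) c - lag B w t c) - (lag B w' (t + 1) c - lag B w' t c) =
      (lag B w (t + 1) c - lag B w' (t + 1) c) - (lag B w t c - lag B w' t c) := by ring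
  rw [h4, h2, h3]
  have h5 : B * (t / B) ≤ B * ((t + 1) / B) :=
    Nat.mul_le_mul_left _ (Nat.div_le_div_right t.le_succ)
  split_ifs
  · simp
  · simpa using h1 c
  · omega
  · simp

theorem abs_exp_neg_sub_le {x y : ℝ} (hx : 0 ≤ x) (hy : 0 ≤ y) :
    |Real.exp (-x) - Real.exp (-y)| ≤ |x - y| := by
  wlog hxy : x ≤ y generalizing x y
  · rw [abs_sub_comm, abs_sub_comm x]
    exact this hy hx (le_of_not_ge hxy)
  rw [abs_of_nonneg (sub_nonneg.2 (Real.exp_le_exp.2 (by linarith))), abs_sub_comm,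
    abs_of_nonneg (sub_nonneg.2 hxy)]
  have h1 := Real.add_one_le_exp (x - y)
  have h2 : Real.exp (-y) = Real.exp (-x) * Real.exp (x - y) := by rw [← Real.exp_add]; ring_nf
  have h3 : Real.exp (-x) ≤ 1 := Real.exp_le_one_iff.2 (by linarith)
  rw [h2]
  nlinarith [Real.exp_pos (-x)]

variable [Fintype M]

theorem sum_exp_pos [Nonempty M] (η : ℝ) (L : M → ℝ) : 0 < ∑ c, Real.exp (-η * L c) :=
  Finset.sum_pos (fun _ _ => Real.exp_pos _) Finset.univ_nonempty

theorem expWeights_pos [Nonempty M] (η : ℝ) (L : M → ℝ) (c : M) : 0 < expWeights η L c :=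
  div_pos (Real.exp_pos _) (sum_exp_pos η L)

theorem sum_expWeights [Nonempty M] (η : ℝ) (L : M → ℝ) : ∑ c, expWeights η L c = 1 := by
  simp only [expWeights]
  rw [← Finset.sum_div, div_self (sum_exp_pos η L).ne']

/-- The bound `a` controls the numerator and `b` the normaliser. Keeping them apart gives `exp (η *
B)` rather than its square for the one-sided lag error. -/
theorem expWeights_le [Nonempty M] {η a b : ℝ} {L L' : M → ℝ}
    (h1 : ∀ c, η * L' c ≤ η * L c + a) (h2 : ∀ c, η * L c ≤ η * L' c + b) (c : M) :
    expWeights η L c ≤ Real.exp (a + b) * expWeights η L' c := by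
  rw [expWeights, expWeights, mul_div_assoc', div_le_div_iff₀ (sum_exp_pos η L) (sum_exp_pos η L')]
  have e1 : Real.exp (-η * L c) ≤ Real.exp a * Real.exp (-η * L' c) := by
    rw [← Real.exp_add]; exact Real.exp_le_exp.2 (by linarith [h1 c])
  have e2 : ∑ c, Real.exp (-η * L' c) ≤ Real.exp b * ∑ c, Real.exp (-η * L c) := by
    rw [Finset.mul_sum]
    refine Finset.sum_le_sum fun c _ => ?_
    rw [← Real.exp_add]; exact Real.exp_le_exp.2 (by linarith [h2 c])
  calc _ ≤ (Real.exp a * Real.exp (-η * L' c)) * (Real.exp b * ∑ c, Real.exp (-η * L c)) :=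
        mul_le_mul e1 e2 (sum_exp_pos η L').le (by positivity)
    _ = _ := by rw [Real.exp_add]; ring

/-- The moments of the likelihood ratio of close distributions. -/
theorem sum_mul_ratio_pow_le {η : ℝ} {n : ℕ} (hn : 1 ≤ n) (hη : 0 ≤ η)
    (hnη : n * (2 * η) ≤ 1) {f f' : M → ℝ} (hf : ∀ c, 0 < f c) (hf' : ∀ c, 0 < f' c)
    (sf : ∑ c, f c = 1) (sf' : ∑ c, f' c = 1) (h1 : ∀ c, f c ≤ Real.exp (2 * η) * f' c)
    (h2 : ∀ c, f' c ≤ Real.exp (2 * η) * f c) :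
    ∑ c, f c * (f c / f' c) ^ n ≤ 1 + 8 * n ^ 2 * η ^ 2 := by
  set Y : M → ℝ := fun c => Real.log (f c / f' c) with hYdef
  have hpos : ∀ c, 0 < f c / f' c := fun c => div_pos (hf c) (hf' c)
  have hn1 : (1 : ℝ) ≤ n := by exact_mod_cast hn
  have hexp : ∀ c, Real.exp (Y c) = f c / f' c := fun c => Real.exp_log (hpos c)
  have hY1 : ∀ c, Y c ≤ 2 * η := fun c => by
    rw [← Real.exp_le_exp, hexp, div_le_iff₀ (hf' c)]
    exact h1 c
  have hY2 : ∀ c, -(2 * η) ≤ Y c := fun c => by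
    rw [← Real.exp_le_exp, hexp, Real.exp_neg, le_div_iff₀ (hf' c),
      inv_mul_le_iff₀ (Real.exp_pos _)]
    exact h2 c
  have hYsq : ∀ c, Y c ^ 2 ≤ 4 * η ^ 2 := fun c => by
    nlinarith [hY1 c, hY2 c]
  have hEY2 : ∑ c, f c * Y c ^ 2 ≤ 4 * η ^ 2 := by
    calc _ ≤ ∑ c, f c * (4 * η ^ 2) :=
          Finset.sum_le_sum fun c _ => mul_le_mul_of_nonneg_left (hYsq c) (hf c).le
      _ = _ := by rw [← Finset.sum_mul, sf, one_mul]
  -- The first moment of the log-ratio `Y` is a relative entropy, hence of second order: `exp (-Y)`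
  -- has mean `1` under `f`, and `exp (-Y) ≤ 1 - Y + Y ^ 2`.
  have hEY : ∑ c, f c * Y c ≤ 4 * η ^ 2 := by
    have h3 : ∀ c, f' c ≤ f c * 1 - f c * Y c + f c * Y c ^ 2 := fun c => by
      have h4 := (abs_le.1 (Real.abs_exp_sub_one_sub_id_le (x := -Y c) (by
        rw [abs_neg, abs_le]; constructor <;> nlinarith [hY1 c, hY2 c]))).2
      have h5 : f' c = f c * Real.exp (-Y c) := by
        rw [Real.exp_neg, hexp]
        have := (hf c).ne'
        field_simp
      rw [h5]
      have := mul_le_mul_of_nonneg_left h4 (hf c).le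
      linarith
    have h6 := Finset.sum_le_sum fun c (_ : c ∈ Finset.univ) => h3 c
    rw [Finset.sum_add_distrib, Finset.sum_sub_distrib, sf', ← Finset.sum_mul, sf] at h6
    linarith
  have h7 : ∀ c, f c * (f c / f' c) ^ n ≤ f c * 1 + n * (f c * Y c) + n ^ 2 * (f c * Y c ^ 2) := by
    intro c
    rw [← hexp, ← Real.exp_nat_mul]
    have h4 := (abs_le.1 (Real.abs_exp_sub_one_sub_id_le (x := n * Y c) (by
        rw [abs_le]; constructor <;> nlinarith [hY1 c, hY2 c]))).2
    have := mul_le_mul_of_nonneg_left h4 (hf c).le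
    linarith
  calc _ ≤ _ := Finset.sum_le_sum fun c _ => h7 c
    _ = 1 + n * ∑ c, f c * Y c + n ^ 2 * ∑ c, f c * Y c ^ 2 := by
      rw [Finset.sum_add_distrib, Finset.sum_add_distrib, ← Finset.sum_mul, sf, ← Finset.mul_sum,
        ← Finset.mul_sum, one_mul]
    _ ≤ 1 + n * (4 * η ^ 2) + n ^ 2 * (4 * η ^ 2) := by gcongr
    _ ≤ _ := by nlinarith [sq_nonneg η, mul_nonneg (sub_nonneg.2 hn1) (sq_nonneg η)]

end weights

/-! ### The lazy algorithm with hidden slots -/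

section lazy

variable {M : Type}

/-- The meta-expert in a slot, if the slot is active. -/
def active : Slot M → Option M
  | some (c, true) => some c
  | _ => none

/-- The meta-expert in the first active slot. -/
def firstActive : {m : ℕ} → (Fin m → Slot M) → Option M
  | 0, _ => none
  | _ + 1, h => (active (h 0)).or (firstActive fun i => h i.succ)

/-- Plays do not reveal whether an inactive slot is dormant or empty; this is why observing a play
preserves `DormantGe`. -/
theorem firstActive_congr {m : ℕ} {h h' : Fin m → Slot M} (hh : ∀ i, active (h i) = active (h' i)) :
    firstActive h = firstActive h' := by
  induction m with
  | zero => rfl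
  | succ m ih => rw [firstActive, firstActive, hh 0, ih fun i => hh i.succ]

/-- The law of a slot that is nonempty with probability `y`. -/
noncomputable def slotLaw (y : ℝ) (p : M → ℝ) : Slot M → ℝ
  | none => 1 - y
  | some (c, _) => y * p c / 2

theorem slotLaw_nonneg {y : ℝ} (hy0 : 0 ≤ y) (hy1 : y ≤ 1) {p : M → ℝ} (hp : ∀ c, 0 ≤ p c)
    (s : Slot M) : 0 ≤ slotLaw y p s := by
  rcases s with _ | ⟨c, _⟩
  · exact sub_nonneg.2 hy1
  · exact div_nonneg (mul_nonneg hy0 (hp c)) two_pos.le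

/-- The rate of the data-independent transitions: `q` at the end of a batch. -/
noncomputable def rate (B : ℕ) (q : ℝ) (t : ℕ) : ℝ := if B ∣ t + 1 then q else 0

theorem rate_nonneg {q : ℝ} (hq : 0 ≤ q) (B t : ℕ) : 0 ≤ rate B q t := by
  rw [rate]; split_ifs <;> linarith

theorem rate_le_one {q : ℝ} (hq : q ≤ 1) (B t : ℕ) : rate B q t ≤ 1 := by
  rw [rate]; split_ifs <;> linarith

/-- The survival probability of active slots in round `t`. -/
noncomputable def survival (B : ℕ) (η : ℝ) (w : ℕ → M → ℝ) (t : ℕ) (c : M) : ℝ :=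
  Real.exp (-(η * (lag B w (t + 1) c - lag B w t c)))

theorem survival_pos (B : ℕ) (η : ℝ) (w : ℕ → M → ℝ) (t : ℕ) (c : M) : 0 < survival B η w t c :=
  Real.exp_pos _

theorem survival_le_one {B : ℕ} {η : ℝ} (hη : 0 ≤ η) {w : ℕ → M → ℝ} (hw : ∀ t c, 0 ≤ w t c)
    (t : ℕ) (c : M) : survival B η w t c ≤ 1 := by
  rw [survival, Real.exp_le_one_iff, neg_nonpos]
  exact mul_nonneg hη (sub_nonneg.2 (lag_le_lag_succ hw t c))

theorem one_sub_survival_le {B : ℕ} {η : ℝ} (hη : 0 ≤ η) {w : ℕ → M → ℝ} (hw : ∀ t c, w t c ≤ 1)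
    (t : ℕ) (c : M) : 1 - survival B η w t c ≤ rate B (η * B) t := by
  have h1 := Real.add_one_le_exp (-(η * (lag B w (t + 1) c - lag B w t c)))
  rw [survival, rate]
  split_ifs with h
  · have := mul_le_mul_of_nonneg_left (lag_succ_le (B := B) hw t c) hη
    linarith
  · rw [lag_succ_of_not_dvd w h] at *
    linarith

theorem survival_congr {B : ℕ} {η : ℝ} {w w' : ℕ → M → ℝ} {t : ℕ} (h : ∀ s ≤ t, w s = w' s) :
    survival B η w t = survival B η w' t := by
  ext c
  rw [survival, survival, lag_congr fun s hs => h s (by omega),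
    lag_congr fun s hs => h s (by omega)]

/-- The loss of meta-experts, if `act t c` is the expert that `c` plays in round `t`. -/
def metaLoss {N : ℕ} (act : ℕ → M → Fin N) (l : ℕ → LossVector N) (t : ℕ) (c : M) : ℝ :=
  l t (act t c)

theorem metaLoss_nonneg {N : ℕ} (act : ℕ → M → Fin N) (l : ℕ → LossVector N) (t : ℕ) (c : M) :
    0 ≤ metaLoss act l t c := (l t (act t c)).2.1

theorem metaLoss_le_one {N : ℕ} (act : ℕ → M → Fin N) (l : ℕ → LossVector N) (t : ℕ) (c : M) :
    metaLoss act l t c ≤ 1 := (l t (act t c)).2.2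

theorem metaLoss_congr {N : ℕ} (act : ℕ → M → Fin N) {l l' : ℕ → LossVector N} {t : ℕ}
    (h : l t = l' t) : metaLoss act l t = metaLoss act l' t := by
  ext c
  rw [metaLoss, metaLoss, h]

variable [Fintype M]

/-- The expectation of `W` over independent slots with law `ν`. -/
def prodExp {m : ℕ} (ν : Slot M → ℝ) : ((Fin m → Slot M) → ℝ) →ₗ[ℝ] ℝ where
  toFun W := ∑ h, (∏ i, ν (h i)) * W h
  map_add' U W := by
    rw [← Finset.sum_add_distrib]
    exact Finset.sum_congr rfl fun h _ => mul_add _ _ _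
  map_smul' a W := by
    rw [RingHom.id_apply, smul_eq_mul, Finset.mul_sum]
    exact Finset.sum_congr rfl fun h _ => mul_left_comm _ _ _

theorem prodExp_apply {m : ℕ} (ν : Slot M → ℝ) (W : (Fin m → Slot M) → ℝ) :
    prodExp ν W = ∑ h, (∏ i, ν (h i)) * W h := rfl

theorem prodExp_nonneg {m : ℕ} {ν : Slot M → ℝ} (hν : ∀ s, 0 ≤ ν s) {W : (Fin m → Slot M) → ℝ}
    (hW : ∀ h, 0 ≤ W h) : 0 ≤ prodExp ν W :=
  Finset.sum_nonneg fun h _ => mul_nonneg (Finset.prod_nonneg fun i _ => hν (h i)) (hW h)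

theorem prodExp_prod {m : ℕ} (ν φ : Slot M → ℝ) :
    prodExp ν (fun h : Fin m → Slot M => ∏ i, φ (h i)) = (∑ s, ν s * φ s) ^ m := by
  rw [prodExp_apply, Fintype.sum_pow]
  exact Finset.sum_congr rfl fun h _ => Finset.prod_mul_distrib.symm

theorem prodExp_one {m : ℕ} {ν : Slot M → ℝ} (hν : ∑ s, ν s = 1) :
    prodExp ν (fun _ : Fin m → Slot M => 1) = 1 := by
  have := prodExp_prod (m := m) ν fun _ => 1
  simpa [hν] using this

theorem sum_slotLaw (y : ℝ) (p : M → ℝ) (u : Slot M → ℝ) :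
    ∑ s, slotLaw y p s * u s = (1 - y) * u none + y * fresh p u := by
  rw [Fintype.sum_option, Fintype.sum_prod_type, fresh, Finset.mul_sum]
  congr 1
  refine Finset.sum_congr rfl fun c _ => ?_
  rw [Fintype.sum_bool]
  simp only [slotLaw]
  ring

theorem sum_slotLaw_one (y : ℝ) {p : M → ℝ} (hp : ∑ c, p c = 1) : ∑ s, slotLaw y p s = 1 := by
  have := sum_slotLaw y p fun _ => 1
  simpa [fresh, hp] using this

/-- The algorithm with `m` hidden slots, batches of `B` rounds, learning rate `η` and rate `q` of
data-independent transitions. It plays what the meta-expert in the first active slot plays. -/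
noncomputable def lazyAlgorithm [Nonempty M] {N : ℕ} (m B : ℕ) {η q : ℝ} (hη : 0 ≤ η) (hq0 : 0 ≤ q)
    (hq1 : q ≤ 1) (d : Fin N) (act : ℕ → M → Fin N) :
    HiddenAlgorithm (Fin m → Slot M) N where
  default := d
  init := prodExp (slotLaw 1 (expWeights η fun _ => 0))
  vis t h := (firstActive h).elim d (act t)
  op l t := sweep (slotOp (rate B q t) q (expWeights η (lag B (metaLoss act l) t))
    (survival B η (metaLoss act l) t)) (List.finRange m)
  init_nonneg _ := prodExp_nonneg
    (slotLaw_nonneg zero_le_one le_rfl fun c => (expWeights_pos η _ c).le)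
  init_one := prodExp_one (sum_slotLaw_one 1 (sum_expWeights η _))
  isPos_op l t := isPos_sweep (isPos_slotOp (rate_nonneg hq0 B t) (rate_le_one hq1 B t) hq0 hq1
    (fun c => (expWeights_pos η _ c).le) (fun c => (survival_pos B η _ t c).le)
    (survival_le_one hη (metaLoss_nonneg act l) t)) _
  op_one l t := sweep_one (slotOp_one _ _ _ (sum_expWeights η _)) _
  op_congr l l' t h := by
    rw [lag_congr fun s hs => metaLoss_congr act (h s hs.le),
      survival_congr fun s hs => metaLoss_congr act (h s hs)]

theorem prod_rate_le {q a : ℝ} (B T : ℕ) :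
    ∏ t ∈ Finset.range T, Real.exp (rate B q t * a) = Real.exp ((T / B : ℕ) * (q * a)) := by
  rw [← Real.exp_sum]
  congr 1
  rw [← Nat.card_multiples T B, Finset.card_filter, Nat.cast_sum, Finset.sum_mul]
  refine Finset.sum_congr rfl fun t _ => ?_
  rw [rate]
  split_ifs <;> simp

end lazy

/-! ### Privacy of the lazy algorithm -/

section privacy

variable {M : Type} [Fintype M] [Nonempty M] {N T : ℕ}

/-- The losses that the strategy `f` chooses against the plays `j`. -/
def lossesAgainst (f : LossFunctions N T) (j : ℕ → Fin N) (s : ℕ) : LossVector N :=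
  if h : s < T then f ⟨s, h⟩ fun i => j i else fun _ => 0

theorem lossesAgainst_extend (f : LossFunctions N T) (d : Fin N) (J : Fin T → Fin N) :
    lossesAgainst f (extend d J) = extend (fun _ => 0) fun t => f t (past J t) := by
  ext1 s
  rw [lossesAgainst, extend]
  split_ifs with h
  · congr 1
    ext1 i
    rw [extend_of_lt _ _ (i.2.trans h)]
    rfl
  · rfl

theorem lossesAgainst_congr (f : LossFunctions N T) {j j' : ℕ → Fin N} {s : ℕ}
    (h : ∀ u < s, j u = j' u) : lossesAgainst f j s = lossesAgainst f j' s := by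
  rw [lossesAgainst, lossesAgainst]
  split_ifs
  · congr 1
    ext1 i
    exact h i i.2
  · rfl

/-- Changing the losses of one round while keeping the resampling distributions. -/
theorem mass_le_of_survival {m B : ℕ} (hB : 0 < B) {η q : ℝ} (hη : 0 ≤ η) (hq0 : 0 < q)
    (hq1 : q ≤ 1) (hηB : η * B ≤ 1 / 3) (d : Fin N) (act : ℕ → M → Fin N) {l l' : ℕ → LossVector N}
    {τ : ℕ} (hl : ∀ s, s ≠ τ → l s = l' s) (j : ℕ → Fin N) (n : ℕ) :
    (lazyAlgorithm m B hη hq0.le hq1 d act).mass l j n ≤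
      ((1 + 4 * η / q) * (1 + 2 * η / q)) ^ m *
      seqExp (lazyAlgorithm m B hη hq0.le hq1 d act).init
        (fun t => obs ((lazyAlgorithm m B hη hq0.le hq1 d act).vis t) (j t) ∘ₗ
          sweep (slotOp (rate B q t) q (expWeights η (lag B (metaLoss act l) t))
            (survival B η (metaLoss act l') t)) (List.finRange m)) n (fun _ => 1) := by
  set w := metaLoss act l with hw
  set w' := metaLoss act l' with hw'
  have hww : ∀ s, s ≠ τ → w s = w' s := fun s hs => metaLoss_congr act (hl s hs)
  have hw1 : ∀ c, |w τ c - w' τ c| ≤ 1 := fun c => by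
    rw [abs_le]
    constructor <;> linarith [metaLoss_nonneg act l τ c, metaLoss_nonneg act l' τ c,
      metaLoss_le_one act l τ c, metaLoss_le_one act l' τ c]
  have hpos : ∀ t, IsPos (slotOp (rate B q t) q (expWeights η (lag B w t)) (survival B η w t)) :=
    fun t => isPos_slotOp (rate_nonneg hq0.le B t) (rate_le_one hq1 B t) hq0.le hq1
      (fun c => (expWeights_pos η _ c).le) (fun c => (survival_pos B η _ t c).le)
      (survival_le_one hη (metaLoss_nonneg act l) t)
  have hpos' : ∀ t, IsPos (slotOp (rate B q t) q (expWeights η (lag B w t)) (survival B η w' t)) :=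
    fun t => isPos_slotOp (rate_nonneg hq0.le B t) (rate_le_one hq1 B t) hq0.le hq1
      (fun c => (expWeights_pos η _ c).le) (fun c => (survival_pos B η _ t c).le)
      (survival_le_one hη (metaLoss_nonneg act l') t)
  have hpres : ∀ t, PreservesDormantGe q
      (slotOp (rate B q t) q (expWeights η (lag B w t)) (survival B η w' t)) := fun t u hu hr c =>
    slotOp_dormant_ge (rate_nonneg hq0.le B t) (rate_le_one hq1 B t) hq1
      (fun c => (survival_pos B η _ t c).le) (survival_le_one hη (metaLoss_nonneg act l') t) hu hr c
  -- The plays `j` being fixed, the two kernels agree except at `batchEnd B τ`. The class `DormantGe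
  -- q` contains the constant `1` and is stable under later transitions and observations, so it
  -- contains the likelihood of the future at that time.
  refine seqExp_le_of_eq_except (b := batchEnd B τ) (C := DormantGe q)
    (HiddenAlgorithm.init_nonneg _)
    (fun t => (isPos_obs _ _).comp (HiddenAlgorithm.isPos_op _ l t)) ?_ ?_ ?_ ?_ (fun W hW => hW.1)
    n ⟨fun _ => zero_le_one, fun _ _ _ => by linarith⟩
  · intro t ht
    have : survival B η w t = survival B η w' t := by
      ext c
      rw [survival, survival, lag_diff_eq hB hww ht]
    simp only [lazyAlgorithm, ← hw, this]
  · intro t W hW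
    have h1 := hW.sweep (hpos' t) (hpres t) (List.finRange m)
    refine ⟨isPos_obs _ _ _ h1.1, fun h i c => ?_⟩
    have h2 : (lazyAlgorithm m B hη hq0.le hq1 d act).vis t (Function.update h i none) =
        (lazyAlgorithm m B hη hq0.le hq1 d act).vis t
          (Function.update h i (some (c, false))) := by
      refine congrArg (fun o : Option M => o.elim d (act t)) (firstActive_congr fun i' => ?_)
      by_cases hi : i' = i
      · subst hi
        simp [active]
      · simp [hi]
    rw [LinearMap.comp_apply, obs_apply, obs_apply, h2]
    split_ifs
    · exact h1.2 h i c
    · simp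
  · refine one_le_pow₀ (one_le_mul_of_one_le_of_one_le ?_ ?_)
    · linarith [show 0 ≤ 4 * η / q by positivity]
    · linarith [show 0 ≤ 2 * η / q by positivity]
  · intro W hW h
    have hrate : rate B q (batchEnd B τ) = q := if_pos (dvd_batchEnd hB τ)
    have h1 := sweep_le_sweep (a := (1 + 4 * η / q) * (1 + 2 * η / q)) (by positivity)
      (hpos (batchEnd B τ)) (hpos' (batchEnd B τ)) (hpres (batchEnd B τ)) (fun u hu hr s => by
        rw [hrate]
        refine slotOp_le_slotOp hq0 hq1 hη (fun c => (expWeights_pos η _ c).le)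
          (survival_le_one hη (metaLoss_nonneg act l) _) (fun c => ?_)
          (survival_le_one hη (metaLoss_nonneg act l') _) (fun c => ?_) hu hr s
        · have h2 := one_sub_survival_le (B := B) hη (metaLoss_le_one act l') (batchEnd B τ) c
          rw [rate, if_pos (dvd_batchEnd hB τ)] at h2
          linarith
        · refine (abs_exp_neg_sub_le
            (mul_nonneg hη (sub_nonneg.2 (lag_le_lag_succ (metaLoss_nonneg act l) _ c)))
            (mul_nonneg hη (sub_nonneg.2 (lag_le_lag_succ (metaLoss_nonneg act l') _ c)))).trans ?_
          rw [← mul_sub, abs_mul, abs_of_nonneg hη]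
          exact mul_le_of_le_one_right hη (abs_lag_diff_le hww hw1 _ c))
      (List.finRange m) hW h
    rw [List.length_finRange] at h1
    rw [LinearMap.comp_apply, LinearMap.comp_apply, obs_apply, obs_apply]
    split_ifs
    · exact h1
    · simp

/-- Hybrid argument: fresh draws follow the first data set and survival follows the second. From the
first law to the hybrid the likelihood changes by a factor `exp (ε / 2)` pointwise; from the hybrid
to the second law the moment bound gives another `exp (ε / 2)` and an additive error whose sum over
all plays is at most `δ`. -/
theorem lazyAlgorithm_isDP {m B n : ℕ} (hB : 0 < B) (hn : 1 ≤ n) {η q ε δ : ℝ} (hη : 0 ≤ η)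
    (hq0 : 0 < q) (hq1 : q ≤ 1) (hηB : η * B ≤ 1 / 3) (hnη : n * (2 * η) ≤ 1)
    (hε : ((1 + 4 * η / q) * (1 + 2 * η / q)) ^ m ≤ Real.exp (ε / 2))
    (hδ : Real.exp (ε / 2) * (Real.exp (-(n * (ε / 2))) * Real.exp ((T / B : ℕ) *
      (m * ((2 * (η * B) + q * q) * (8 * n ^ 2 * η ^ 2))))) ≤ δ)
    (d : Fin N) (act : ℕ → M → Fin N) :
    ((lazyAlgorithm m B hη hq0.le hq1 d act).toOnline T).IsDP ε δ := by
  intro Z adv z z' hz E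
  obtain ⟨τ, -, hτ⟩ := hz
  set A := lazyAlgorithm m B hη hq0.le hq1 d act with hA
  set f := adv.run z
  set f' := adv.run z'
  have hff : ∀ (j : ℕ → Fin N) (s : ℕ), s ≠ (τ : ℕ) → lossesAgainst f j s = lossesAgainst f' j s := by
    intro j s hs
    rw [lossesAgainst, lossesAgainst]
    split_ifs with h
    · have : z ⟨s, h⟩ = z' ⟨s, h⟩ := hτ _ fun e => hs (by rw [← e])
      simp only [f, f', AdaptiveAdversary.run, this]
    · rfl
  let W : (ℕ → Fin N) → ℕ → M → ℝ := fun j => metaLoss act (lossesAgainst f j)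
  let W' : (ℕ → Fin N) → ℕ → M → ℝ := fun j => metaLoss act (lossesAgainst f' j)
  have hWW : ∀ j (s : ℕ), s ≠ (τ : ℕ) → W j s = W' j s := fun j s hs => metaLoss_congr act (hff j s hs)
  have hW1 : ∀ j t c, |lag B (W j) t c - lag B (W' j) t c| ≤ 1 := fun j t c =>
    abs_lag_sub_lag_le (hWW j) (fun c => by
      rw [abs_le]
      constructor <;> linarith [metaLoss_nonneg act (lossesAgainst f j) τ c,
        metaLoss_nonneg act (lossesAgainst f' j) τ c, metaLoss_le_one act (lossesAgainst f j) τ c,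
        metaLoss_le_one act (lossesAgainst f' j) τ c]) t c
  let R : (ℕ → Fin N) → ℕ → ((Fin m → Slot M) → ℝ) →ₗ[ℝ] ((Fin m → Slot M) → ℝ) := fun j t =>
    sweep (slotOp (rate B q t) q (fun c => expWeights η (lag B (W j) t) c *
      (expWeights η (lag B (W j) t) c / expWeights η (lag B (W' j) t) c) ^ n)
      (survival B η (W' j) t)) (List.finRange m)
  have hfpos : ∀ j t c, 0 < expWeights η (lag B (W j) t) c := fun j t c => expWeights_pos _ _ _
  have hfpos' : ∀ j t c, 0 < expWeights η (lag B (W' j) t) c := fun j t c => expWeights_pos _ _ _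
  have hs0 : ∀ j t c, 0 ≤ survival B η (W' j) t c := fun j t c => (survival_pos _ _ _ _ _).le
  have hs1 : ∀ j t c, survival B η (W' j) t c ≤ 1 := fun j t c =>
    survival_le_one hη (metaLoss_nonneg act _) t c
  have hRpos : ∀ j t, IsPos (slotOp (rate B q t) q (fun c => expWeights η (lag B (W j) t) c *
      (expWeights η (lag B (W j) t) c / expWeights η (lag B (W' j) t) c) ^ n)
      (survival B η (W' j) t)) := fun j t =>
    isPos_slotOp (rate_nonneg hq0.le B t) (rate_le_one hq1 B t) hq0.le hq1
      (fun c => by have := hfpos j t c; have := hfpos' j t c; positivity) (hs0 j t) (hs1 j t)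
  set x : ℝ := 1 + 8 * n ^ 2 * η ^ 2 with hx
  have hx1 : 1 ≤ x := by rw [hx]; linarith [show 0 ≤ 8 * (n : ℝ) ^ 2 * η ^ 2 by positivity]
  -- `rate B 1 t` is the indicator that round `t` ends a batch; in other rounds the kernels do
  -- nothing.
  set a : ℕ → ℝ := fun t => Real.exp (rate B 1 t * (m * ((2 * (η * B) + q * q) * (x - 1)))) with ha
  have hRa : ∀ j t h, R j t (potential x) h ≤ a t * potential x h := by
    intro j t h
    have hratio : ∀ c, η * lag B (W j) t c ≤ η * lag B (W' j) t c + η ∧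
        η * lag B (W' j) t c ≤ η * lag B (W j) t c + η := fun c => by
      have := abs_le.1 (hW1 j t c)
      constructor <;> nlinarith
    have hsum : ∑ c, expWeights η (lag B (W j) t) c *
        (expWeights η (lag B (W j) t) c / expWeights η (lag B (W' j) t) c) ^ n ≤ x := by
      refine sum_mul_ratio_pow_le hn hη hnη (hfpos j t) (hfpos' j t) (sum_expWeights _ _)
        (sum_expWeights _ _) (fun c => ?_) fun c => ?_
      · rw [two_mul]
        exact expWeights_le (fun c => (hratio c).2) (fun c => (hratio c).1) c
      · rw [two_mul]
        exact expWeights_le (fun c => (hratio c).1) (fun c => (hratio c).2) c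
    have h1 := sweep_potential_le (Real.exp_pos ((2 * rate B (η * B) t + rate B q t * q) *
      (x - 1))).le hx1 (hRpos j t) (slotOp_slotPotential_le (rate_nonneg hq0.le B t)
        (rate_le_one hq1 B t) hq0.le hq1 (rate_nonneg (by positivity) B t) hx1
        (fun c => by have := hfpos j t c; have := hfpos' j t c; positivity) hsum (hs0 j t) (hs1 j t)
        (one_sub_survival_le hη (metaLoss_le_one act _) t)) (List.finRange m) h
    rw [List.length_finRange, ← Real.exp_nat_mul] at h1
    refine h1.trans (le_of_eq ?_)
    rw [ha]
    congr 2
    simp only [rate]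
    split_ifs <;> ring
  have hRj : ∀ j j' t, (∀ s ≤ t, j s = j' s) → R j t = R j' t := by
    intro j j' t h
    have e1 : ∀ s ≤ t, W j s = W j' s := fun s hs =>
      metaLoss_congr act (lossesAgainst_congr f fun u hu => h u (by omega))
    have e2 : ∀ s ≤ t, W' j s = W' j' s := fun s hs =>
      metaLoss_congr act (lossesAgainst_congr f' fun u hu => h u (by omega))
    simp only [R]
    rw [lag_congr fun s hs => e1 s hs.le, lag_congr fun s hs => e2 s hs.le, survival_congr e2]
  -- No slot is empty at the start, since the initial law has `y = 1`.
  have hinit : A.init (potential x) = 1 := by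
    simp only [hA, lazyAlgorithm]
    have h1 := prodExp_prod (m := m) (slotLaw 1 (expWeights η fun _ : M => 0)) (slotPotential x)
    rw [sum_slotLaw] at h1
    have h2 : fresh (expWeights η fun _ : M => 0) (slotPotential x) = 1 := by
      simp [fresh, slotPotential, sum_expWeights]
    rw [h2] at h1
    exact h1.trans (by simp)
  have hmom := sum_seqExp_le d A.init_nonneg (vis := A.vis)
    (fun j t => isPos_sweep (hRpos j t) (List.finRange m)) hRj hRa (fun t => (Real.exp_pos _).le) T
  rw [hinit, mul_one, prod_rate_le, one_mul] at hmom
  set mom : (Fin T → Fin N) → ℝ := fun J =>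
    seqExp A.init (fun s => obs (A.vis s) (extend d J s) ∘ₗ R (extend d J) s) T (potential x)
  have hmom0 : ∀ J, 0 ≤ mom J := fun J => seqExp_nonneg A.init_nonneg
    (fun t => (isPos_obs _ _).comp (isPos_sweep (hRpos _ t) _)) T
    fun h => zero_le_one.trans (one_le_potential hx1 h)
  have key : ∀ J : Fin T → Fin N, (A.toOnline T).law f J ≤
      Real.exp ε * (A.toOnline T).law f' J +
        Real.exp (ε / 2) * (Real.exp (-(n * (ε / 2))) * mom J) := by
    intro J
    rw [A.law_toOnline, A.law_toOnline, ← lossesAgainst_extend f A.default,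
      ← lossesAgainst_extend f' A.default]
    have hd : A.default = d := rfl
    rw [hd]
    set j := extend d J
    have h1 := mass_le_of_survival (m := m) hB hη hq0 hq1 hηB d act (hff j) j T
    -- The induction starts at the horizon from `1 ≤ s + s⁻¹ ^ n * potential x h`, which holds for
    -- `s ≥ 1` and for `s ≤ 1` since the potential is at least `1`. Choosing `s = exp (ε / 2)` at
    -- the end is Markov's inequality for the `n`-th moment.
    have h2 := seqExp_momentDom A.init_nonneg (p := n)
      (k := fun t => obs (A.vis t) (j t) ∘ₗ sweep (slotOp (rate B q t) q
        (expWeights η (lag B (W j) t)) (survival B η (W' j) t)) (List.finRange m))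
      (k' := fun t => obs (A.vis t) (j t) ∘ₗ A.op (lossesAgainst f' j) t)
      (R := fun t => obs (A.vis t) (j t) ∘ₗ R j t)
      (fun t => (MomentDom.of_isPos n (isPos_obs _ _)).comp
        ((MomentDom.slotOp n (rate_nonneg hq0.le B t) (rate_le_one hq1 B t) hq0.le hq1
          (hfpos j t) (hfpos' j t) (hs0 j t) (hs1 j t)).sweep _)) T
      (u := fun _ => 1) (v := fun _ => 1) (w := potential x) (fun s hs h => by
        have hP := one_le_potential hx1 h
        rcases le_total 1 s with h1s | h1s
        · have : 0 ≤ s⁻¹ ^ n * potential x h := by positivity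
          linarith
        · have : 1 ≤ s⁻¹ ^ n := one_le_pow₀ ((one_le_inv₀ hs).2 h1s)
          nlinarith)
      (Real.exp_pos (ε / 2))
    rw [← Real.exp_neg, ← Real.exp_nat_mul, mul_neg] at h2
    have h3 := A.mass_nonneg (lossesAgainst f' j) j T
    have h4 := hmom0 J
    set Hyb := seqExp A.init (fun t => obs (A.vis t) (j t) ∘ₗ sweep (slotOp (rate B q t) q
        (expWeights η (lag B (W j) t)) (survival B η (W' j) t)) (List.finRange m)) T (fun _ => 1)
    have hHyb : 0 ≤ Hyb := seqExp_nonneg A.init_nonneg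
      (fun t => (isPos_obs _ _).comp (isPos_sweep (isPos_slotOp (rate_nonneg hq0.le B t)
        (rate_le_one hq1 B t) hq0.le hq1 (fun c => (hfpos j t c).le) (hs0 j t) (hs1 j t)) _)) T
      fun _ => zero_le_one
    calc _ ≤ ((1 + 4 * η / q) * (1 + 2 * η / q)) ^ m * Hyb := h1
      _ ≤ Real.exp (ε / 2) * Hyb := mul_le_mul_of_nonneg_right hε hHyb
      _ ≤ Real.exp (ε / 2) * (Real.exp (ε / 2) * A.mass (lossesAgainst f' j) j T +
          Real.exp (-(n * (ε / 2))) * mom J) :=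
        mul_le_mul_of_nonneg_left h2 (Real.exp_pos _).le
      _ = _ := by
        have : Real.exp ε = Real.exp (ε / 2) * Real.exp (ε / 2) := by
          rw [← Real.exp_add]; ring_nf
        rw [this]; ring
  rw [OnlineAlgorithm.prob, OnlineAlgorithm.prob]
  calc _ ≤ _ := Finset.sum_le_sum fun J (_ : J ∈ E) => key J
    _ = Real.exp ε * ∑ J ∈ E, (A.toOnline T).law f' J +
        Real.exp (ε / 2) * (Real.exp (-(n * (ε / 2))) * ∑ J ∈ E, mom J) := by
      rw [Finset.sum_add_distrib, ← Finset.mul_sum, ← Finset.mul_sum, ← Finset.mul_sum]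
    _ ≤ _ := by
      refine add_le_add le_rfl (le_trans ?_ hδ)
      have h1 : ∑ J ∈ E, mom J ≤ ∑ J, mom J :=
        Finset.sum_le_sum_of_subset_of_nonneg (Finset.subset_univ _) fun J _ _ => hmom0 J
      have h2 : x - 1 = 8 * n ^ 2 * η ^ 2 := by rw [hx]; ring
      rw [h2] at hmom
      exact mul_le_mul_of_nonneg_left (mul_le_mul_of_nonneg_left (h1.trans hmom)
        (Real.exp_pos _).le) (Real.exp_pos _).le

end privacy

/-! ### The law of the hidden state against oblivious losses -/

section stationary

variable {M : Type} [Fintype M] {m : ℕ}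

/-- A slot is active with probability `y / 2`, independently of its content. So the first active
slot, if there is one, has content distributed as `p`. -/
theorem prodExp_firstActive (m : ℕ) (y : ℝ) {p : M → ℝ} (hp : ∑ c, p c = 1) (F : Option M → ℝ) :
    prodExp (slotLaw y p) (fun h : Fin m → Slot M => F (firstActive h)) =
      (1 - (1 - y / 2) ^ m) * ∑ c, p c * F (some c) + (1 - y / 2) ^ m * F none := by
  induction m with
  | zero => simp [prodExp_apply, firstActive]
  | succ m ih =>
    set G := prodExp (slotLaw y p) (fun h : Fin m → Slot M => F (firstActive h)) with hG
    have h1 : prodExp (slotLaw y p) (fun h : Fin (m + 1) → Slot M => F (firstActive h)) =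
        ∑ s, slotLaw y p s * prodExp (slotLaw y p)
          (fun h : Fin m → Slot M => F ((active s).or (firstActive h))) := by
      rw [prodExp_apply, ← (Fin.consEquiv fun _ : Fin (m + 1) => Slot M).sum_comp,
        Fintype.sum_prod_type]
      refine Finset.sum_congr rfl fun s _ => ?_
      rw [prodExp_apply, Finset.mul_sum]
      refine Finset.sum_congr rfl fun h _ => ?_
      rw [Fin.prod_univ_succ, mul_assoc]
      rfl
    have h2 : ∀ c, prodExp (slotLaw y p)
        (fun h : Fin m → Slot M => F ((active (some (c, true))).or (firstActive h))) =
          F (some c) := by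
      intro c
      have := map_smul (prodExp (slotLaw y p) : ((Fin m → Slot M) → ℝ) →ₗ[ℝ] ℝ) (F (some c))
        (fun _ => 1)
      rw [prodExp_one (sum_slotLaw_one y hp), smul_eq_mul, mul_one] at this
      rw [← this]
      congr 1
      ext h
      simp [active]
    have h3 : ∀ c, prodExp (slotLaw y p)
        (fun h : Fin m → Slot M => F ((active (some (c, false))).or (firstActive h))) = G := by
      intro c
      simp [active, hG]
    have h4 : prodExp (slotLaw y p)
        (fun h : Fin m → Slot M => F ((active none).or (firstActive h))) = G := by
      simp [active, hG]
    rw [h1, sum_slotLaw, h4, fresh]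
    simp only [h2, h3]
    have h5 : ∑ c, p c * ((F (some c) + G) / 2) = (∑ c, p c * F (some c)) / 2 + G / 2 := by
      rw [Finset.sum_div]
      have : G / 2 = ∑ c, p c * (G / 2) := by rw [← Finset.sum_mul, hp, one_mul]
      rw [this, ← Finset.sum_add_distrib]
      exact Finset.sum_congr rfl fun c _ => by ring
    rw [h5, ih]
    ring

/-- Swapping coordinate `i` of `h` with the extra slot `s` is an involution. The identity isolates
one coordinate of a sum over configurations without splitting the product type. -/
theorem card_mul_sum_eq_sum_update (i : Fin m) (G : (Fin m → Slot M) → ℝ) :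
    (Fintype.card (Slot M) : ℝ) * ∑ h, G h = ∑ h, ∑ s, G (Function.update h i s) := by
  rw [← Fintype.sum_prod_type' fun h s => G (Function.update h i s)]
  have e : Function.Involutive fun x : (Fin m → Slot M) × Slot M =>
      (Function.update x.1 i x.2, x.1 i) := fun x => by simp
  refine Eq.trans ?_ (Equiv.sum_comp (e.toPerm _)
    fun x : (Fin m → Slot M) × Slot M => G (Function.update x.1 i x.2))
  simp [Fintype.sum_prod_type, Function.Involutive.coe_toPerm, Finset.mul_sum]

theorem sum_prod_mul_slotAct {k : (Slot M → ℝ) →ₗ[ℝ] (Slot M → ℝ)} {ν₀ ν₁ : Slot M → ℝ}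
    (hk : ∀ u, ∑ s, ν₀ s * k u s = ∑ s, ν₁ s * u s) {ν : Fin m → Slot M → ℝ} {i : Fin m}
    (hi : ν i = ν₀) (W : (Fin m → Slot M) → ℝ) :
    ∑ h, (∏ j, ν j (h j)) * slotAct k i W h =
      ∑ h, (∏ j, Function.update ν i ν₁ j (h j)) * W h := by
  have hc : (Fintype.card (Slot M) : ℝ) ≠ 0 := by
    exact_mod_cast Fintype.card_ne_zero
  refine mul_left_cancel₀ hc ?_
  rw [card_mul_sum_eq_sum_update i, card_mul_sum_eq_sum_update i]
  refine Finset.sum_congr rfl fun h _ => ?_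
  have h1 : ∀ s, ∏ j, ν j (Function.update h i s j) =
      ν₀ s * ∏ j ∈ Finset.univ.erase i, ν j (h j) := fun s => by
    rw [← Finset.mul_prod_erase _ _ (Finset.mem_univ i), Function.update_self, hi]
    congr 1
    exact Finset.prod_congr rfl fun j hj => by
      rw [Function.update_of_ne (Finset.ne_of_mem_erase hj)]
  have h2 : ∀ s, ∏ j, Function.update ν i ν₁ j (Function.update h i s j) =
      ν₁ s * ∏ j ∈ Finset.univ.erase i, ν j (h j) := fun s => by
    rw [← Finset.mul_prod_erase _ _ (Finset.mem_univ i), Function.update_self,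
      Function.update_self]
    congr 1
    exact Finset.prod_congr rfl fun j hj => by
      rw [Function.update_of_ne (Finset.ne_of_mem_erase hj),
        Function.update_of_ne (Finset.ne_of_mem_erase hj)]
  simp only [h1, h2, slotAct_update_self]
  have h3 := congrArg (fun x => (∏ j ∈ Finset.univ.erase i, ν j (h j)) * x)
    (hk fun s => W (Function.update h i s))
  simp only [Finset.mul_sum] at h3
  calc _ = _ := Finset.sum_congr rfl fun s _ => by ring
    _ = _ := h3
    _ = _ := Finset.sum_congr rfl fun s _ => by ring

theorem sum_prod_mul_sweep {k : (Slot M → ℝ) →ₗ[ℝ] (Slot M → ℝ)} {ν₀ ν₁ : Slot M → ℝ}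
    (hk : ∀ u, ∑ s, ν₀ s * k u s = ∑ s, ν₁ s * u s) {is : List (Fin m)} (his : is.Nodup)
    {ν : Fin m → Slot M → ℝ} (hν : ∀ i ∈ is, ν i = ν₀) (W : (Fin m → Slot M) → ℝ) :
    ∑ h, (∏ j, ν j (h j)) * sweep k is W h =
      ∑ h, (∏ j, (if j ∈ is then ν₁ else ν j) (h j)) * W h := by
  induction is generalizing ν with
  | nil => simp [sweep]
  | cons i is ih =>
    rw [List.nodup_cons] at his
    have h1 := sum_prod_mul_slotAct hk (hν i List.mem_cons_self) (sweep k is W)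
    have h2 := ih his.2 (ν := Function.update ν i ν₁) fun j hj => by
      rw [Function.update_of_ne (ne_of_mem_of_not_mem hj his.1)]
      exact hν j (List.mem_cons_of_mem _ hj)
    refine h1.trans (h2.trans (Finset.sum_congr rfl fun h _ => ?_))
    congr 1
    refine Finset.prod_congr rfl fun j _ => ?_
    by_cases hj : j = i
    · subst hj
      simp [his.1]
    · simp [hj]

theorem prodExp_sweep {k : (Slot M → ℝ) →ₗ[ℝ] (Slot M → ℝ)} {ν₀ ν₁ : Slot M → ℝ}
    (hk : ∀ u, ∑ s, ν₀ s * k u s = ∑ s, ν₁ s * u s) (W : (Fin m → Slot M) → ℝ) :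
    prodExp ν₀ (sweep k (List.finRange m) W) = prodExp ν₁ W := by
  rw [prodExp_apply, prodExp_apply,
    sum_prod_mul_sweep (ν := fun _ => ν₀) hk (List.nodup_finRange m) fun _ _ => rfl]
  simp

/-- The flows balance. Active slots fall dormant at rate `r * (1 - q / 2)`; dormant ones become
active at rate `r * (1 - q)` directly and `r * q / 2` through a fresh active draw. Only the filling
of empty slots changes the law. -/
theorem sum_slotLaw_mul_ringOp (y r q : ℝ) {p : M → ℝ} (hp : ∑ c, p c = 1) (u : Slot M → ℝ) :
    ∑ s, slotLaw y p s * ringOp r q p u s = ∑ s, slotLaw (y + (1 - y) * r) p s * u s := by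
  rw [sum_slotLaw, sum_slotLaw, ringOp_none]
  have : fresh p (ringOp r q p u) =
      (1 - r * q / 2) * fresh p u + r * q / 2 * fresh p u := by
    have h1 : r * q / 2 * fresh p u = ∑ c, p c * (r * q / 2 * fresh p u) := by
      rw [← Finset.sum_mul, hp, one_mul]
    rw [h1]
    generalize hF : r * q / 2 * fresh p u = F at *
    rw [fresh, fresh, Finset.mul_sum, ← Finset.sum_add_distrib]
    refine Finset.sum_congr rfl fun c _ => ?_
    rw [ringOp_active, ringOp_dormant, ← hF]
    ring
  rw [this]
  ring

/-- This dictates the form of `keep`: dormant mass after the loss stage is proportional to `keep g *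
(1 + (1 - g))`, which equals `g`, the factor for active mass. So both halves are reweighted by `g`,
as exponential weights require. -/
theorem sum_slotLaw_mul_lossOp (y : ℝ) {p p' g : M → ℝ} {ρ : ℝ} (hp : ∑ c, p c = 1)
    (hg : ∀ c, g c ≤ 1) (hρ : ∑ c, p c * g c = ρ) (hp' : ∀ c, ρ * p' c = p c * g c)
    (u : Slot M → ℝ) :
    ∑ s, slotLaw y p s * lossOp g u s = ∑ s, slotLaw (y * ρ) p' s * u s := by
  rw [sum_slotLaw, sum_slotLaw, lossOp_none]
  have : fresh p (lossOp g u) = ρ * fresh p' u + (1 - ρ) * u none := by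
    have e1 : (1 - ρ) * u none = ∑ c, (p c - p c * g c) * u none := by
      rw [← Finset.sum_mul, Finset.sum_sub_distrib, hp, hρ]
    rw [e1, fresh, fresh, Finset.mul_sum, ← Finset.sum_add_distrib]
    refine Finset.sum_congr rfl fun c _ => ?_
    rw [lossOp_active, lossOp_dormant, ← mul_assoc, hp']
    have h2 : 2 - g c ≠ 0 := by linarith [hg c]
    rw [keep]
    field_simp
    ring
  rw [this]
  ring

theorem seqExp_lazy [Nonempty M] {N : ℕ} {B : ℕ} {η q : ℝ} (hη : 0 ≤ η) (hq0 : 0 ≤ q)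
    (hq1 : q ≤ 1) (hηB : η * B ≤ q / 4) (d : Fin N) (act : ℕ → M → Fin N)
    (l : ℕ → LossVector N) (t : ℕ) :
    ∃ y : ℝ, 3 / 4 ≤ y ∧ y ≤ 1 ∧ ∀ W : (Fin m → Slot M) → ℝ,
      seqExp (lazyAlgorithm m B hη hq0 hq1 d act).init
        ((lazyAlgorithm m B hη hq0 hq1 d act).op l) t W =
      prodExp (slotLaw y (expWeights η (lag B (metaLoss act l) t))) W := by
  induction t with
  | zero =>
    refine ⟨1, by norm_num, le_rfl, fun W => ?_⟩
    have : lag B (metaLoss act l) 0 = fun _ => 0 := by ext c; simp [lag]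
    rw [this]
    rfl
  | succ t ih =>
    obtain ⟨y, hy0, hy1, hy⟩ := ih
    set w := metaLoss act l with hw
    set p := expWeights η (lag B w t) with hp
    set g := survival B η w t with hg
    set r := rate B q t with hr
    have hr0 : 0 ≤ r := rate_nonneg hq0 B t
    have hr1 : r ≤ 1 := rate_le_one hq1 B t
    have hp1 : ∑ c, p c = 1 := sum_expWeights _ _
    have hp0 : ∀ c, 0 < p c := expWeights_pos _ _
    have hg1 : ∀ c, g c ≤ 1 := survival_le_one hη (metaLoss_nonneg act l) t
    have hg2 : ∀ c, 1 - r / 4 ≤ g c := fun c => by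
      have h1 := one_sub_survival_le (B := B) hη (metaLoss_le_one act l) t c
      have h2 : rate B (η * B) t ≤ r / 4 := by
        rw [hr, rate, rate]; split_ifs <;> linarith
      linarith
    set ρ := ∑ c, p c * g c with hρ
    have hρ1 : ρ ≤ 1 := by
      rw [← hp1]
      exact Finset.sum_le_sum fun c _ => mul_le_of_le_one_right (hp0 c).le (hg1 c)
    have hρ2 : 1 - r / 4 ≤ ρ := by
      calc 1 - r / 4 = ∑ c, p c * (1 - r / 4) := by rw [← Finset.sum_mul, hp1, one_mul]
        _ ≤ ρ := Finset.sum_le_sum fun c _ => mul_le_mul_of_nonneg_left (hg2 c) (hp0 c).le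
    have hmul : ∀ c, Real.exp (-η * lag B w t c) * g c = Real.exp (-η * lag B w (t + 1) c) := by
      intro c
      rw [hg, survival, ← Real.exp_add]
      ring_nf
    have hp' : ∀ c, ρ * expWeights η (lag B w (t + 1)) c = p c * g c := by
      intro c
      have hZ := sum_exp_pos η (lag B w t)
      have hZ' := sum_exp_pos η (lag B w (t + 1))
      have h1 : ρ = (∑ c, Real.exp (-η * lag B w (t + 1) c)) / ∑ c, Real.exp (-η * lag B w t c) := by
        rw [hρ, Finset.sum_div]
        refine Finset.sum_congr rfl fun c _ => ?_
        rw [hp, expWeights, div_mul_eq_mul_div, hmul]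
      rw [h1, hp, expWeights, expWeights, div_mul_eq_mul_div _ _ (g c), hmul]
      field_simp
    refine ⟨(y + (1 - y) * r) * ρ, ?_, ?_, fun W => ?_⟩
    -- The level `3 / 4` is self-sustaining: refilling adds at least `r / 4` to it and the loss
    -- stage removes at most the fraction `r / 4`.
    · have h1 : 3 / 4 + r / 4 ≤ y + (1 - y) * r := by nlinarith
      calc (3 : ℝ) / 4 ≤ (3 / 4 + r / 4) * (1 - r / 4) := by nlinarith
        _ ≤ _ := mul_le_mul h1 hρ2 (by linarith) (by nlinarith)
    · have h1 : y + (1 - y) * r ≤ 1 := by nlinarith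
      have h2 : 0 ≤ ρ := by linarith
      nlinarith
    · rw [seqExp_succ, hy]
      refine prodExp_sweep (fun u => ?_) W
      rw [slotOp, LinearMap.comp_apply, sum_slotLaw_mul_ringOp y r q hp1,
        sum_slotLaw_mul_lossOp _ hp1 hg1 rfl hp']

/-- Up to the event that no slot is active, the algorithm plays from the exponential weights. -/
theorem seqExp_lazy_vis_le [Nonempty M] {N : ℕ} {B : ℕ} {η q : ℝ} (hη : 0 ≤ η) (hq0 : 0 ≤ q)
    (hq1 : q ≤ 1) (hηB : η * B ≤ q / 4) (d : Fin N) (act : ℕ → M → Fin N)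
    (l : ℕ → LossVector N) (t : ℕ) :
    seqExp (lazyAlgorithm m B hη hq0 hq1 d act).init
        ((lazyAlgorithm m B hη hq0 hq1 d act).op l) t
        (fun h => (l t ((lazyAlgorithm m B hη hq0 hq1 d act).vis t h) : ℝ)) ≤
      ∑ c, expWeights η (lag B (metaLoss act l) t) c * metaLoss act l t c + (5 / 8) ^ m := by
  obtain ⟨y, hy0, hy1, hy⟩ := seqExp_lazy (m := m) hη hq0 hq1 hηB d act l t
  rw [hy]
  have h1 := prodExp_firstActive m y (sum_expWeights η (lag B (metaLoss act l) t))
    fun o => (l t (o.elim d (act t)) : ℝ)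
  refine (le_of_eq h1).trans ?_
  have h2 : (0 : ℝ) ≤ (1 - y / 2) ^ m := pow_nonneg (by linarith) m
  have h3 : (1 - y / 2) ^ m ≤ (5 / 8) ^ m := pow_le_pow_left₀ (by linarith) (by linarith) m
  have h4 : 0 ≤ ∑ c, expWeights η (lag B (metaLoss act l) t) c * metaLoss act l t c :=
    Finset.sum_nonneg fun c _ => mul_nonneg (expWeights_pos _ _ c).le (metaLoss_nonneg act l t c)
  have h5 : (l t d : ℝ) ≤ 1 := (l t d).2.2
  simp only [Option.elim_some, Option.elim_none]
  change (1 - (1 - y / 2) ^ m) * ∑ c, expWeights η (lag B (metaLoss act l) t) c * metaLoss act l t c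
    + (1 - y / 2) ^ m * (l t d : ℝ) ≤ _
  nlinarith

end stationary

/-! ### The regret of exponential weights -/

section regret

variable {M : Type} [Fintype M] [Nonempty M]

/-- Potential argument: the normaliser `Z` shrinks in each round by a factor `exp (-η * a t + η ^
2)`, while it always exceeds the weight of `c₀`. -/
theorem sum_expWeights_mul_le {η : ℝ} (hη : 0 < η) (hη1 : η ≤ 1) {w : ℕ → M → ℝ}
    (hw0 : ∀ t c, 0 ≤ w t c) (hw1 : ∀ t c, w t c ≤ 1) (n : ℕ) (c₀ : M) :
    ∑ t ∈ Finset.range n, ∑ c, expWeights η (fun c => ∑ s ∈ Finset.range t, w s c) c * w t c ≤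
      ∑ t ∈ Finset.range n, w t c₀ + Real.log (Fintype.card M) / η + η * n := by
  set L : ℕ → M → ℝ := fun t c => ∑ s ∈ Finset.range t, w s c with hL
  set Z : ℕ → ℝ := fun t => ∑ c, Real.exp (-η * L t c) with hZ
  set a : ℕ → ℝ := fun t => ∑ c, expWeights η (L t) c * w t c with ha
  have hZpos : ∀ t, 0 < Z t := fun t => sum_exp_pos η (L t)
  have hstep : ∀ t, Z (t + 1) ≤ Z t * Real.exp (-η * a t + η ^ 2) := by
    intro t
    have h1 : Z (t + 1) = Z t * ∑ c, expWeights η (L t) c * Real.exp (-η * w t c) := by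
      rw [Finset.mul_sum]
      refine Finset.sum_congr rfl fun c _ => ?_
      have h2 : Real.exp (-η * L (t + 1) c) =
          Real.exp (-η * L t c) * Real.exp (-η * w t c) := by
        rw [← Real.exp_add, hL]
        simp only [Finset.sum_range_succ]
        ring_nf
      rw [h2, expWeights, ← mul_assoc, mul_div_cancel₀ _ (hZpos t).ne']
    have h3 : ∑ c, expWeights η (L t) c * Real.exp (-η * w t c) ≤ 1 + (-η * a t + η ^ 2) := by
      calc _ ≤ ∑ c, (expWeights η (L t) c * (1 + η ^ 2) +
            -η * (expWeights η (L t) c * w t c)) := by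
            refine Finset.sum_le_sum fun c _ => ?_
            have h4 : |(-η * w t c)| ≤ 1 := by
              rw [abs_le]
              constructor <;> nlinarith [hw0 t c, hw1 t c]
            have h5 := (abs_le.1 (Real.abs_exp_sub_one_sub_id_le h4)).2
            have h6 : (-η * w t c) ^ 2 ≤ η ^ 2 := by
              have : w t c ^ 2 ≤ 1 := by nlinarith [hw0 t c, hw1 t c]
              rw [mul_pow, neg_sq]
              nlinarith [sq_nonneg η]
            have := mul_le_mul_of_nonneg_left
              (show Real.exp (-η * w t c) ≤ 1 + η ^ 2 + -η * w t c by linarith)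
              (expWeights_pos η (L t) c).le
            linarith
        _ = _ := by
            rw [Finset.sum_add_distrib, ← Finset.sum_mul, sum_expWeights, ← Finset.mul_sum]
            ring
    rw [h1]
    refine mul_le_mul_of_nonneg_left (h3.trans ?_) (hZpos t).le
    linarith [Real.add_one_le_exp (-η * a t + η ^ 2)]
  have hZn : ∀ n : ℕ, Z n ≤ Fintype.card M *
      Real.exp (-η * ∑ t ∈ Finset.range n, a t + η ^ 2 * n) := by
    intro n
    induction n with
    | zero => simp [hZ, hL]
    | succ n ih =>
      calc _ ≤ _ := hstep n
        _ ≤ _ := mul_le_mul_of_nonneg_right ih (Real.exp_pos _).le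
        _ = _ := by
          rw [mul_assoc, ← Real.exp_add, Finset.sum_range_succ]
          push_cast
          ring_nf
  have hcard : (0 : ℝ) < Fintype.card M := by exact_mod_cast Fintype.card_pos
  have h1 : Real.exp (-η * L n c₀) ≤ Fintype.card M *
      Real.exp (-η * ∑ t ∈ Finset.range n, a t + η ^ 2 * n) :=
    (Finset.single_le_sum (f := fun c => Real.exp (-η * L n c)) (fun c _ => (Real.exp_pos _).le)
      (Finset.mem_univ c₀)).trans (hZn n)
  have h2 := Real.log_le_log (Real.exp_pos _) h1
  rw [Real.log_exp, Real.log_mul hcard.ne' (Real.exp_pos _).ne', Real.log_exp] at h2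
  have h3 : η * ∑ t ∈ Finset.range n, a t ≤ η * (L n c₀ + Real.log (Fintype.card M) / η + η * n) := by
    rw [mul_add, mul_add, mul_div_cancel₀ _ hη.ne']
    linarith
  exact le_of_mul_le_mul_left h3 hη

/-- The lagged sums miss fewer than `B` rounds, so the lagged weights exceed the current ones by at
most a factor `exp (η * B) ≤ 1 + 2 * (η * B)`. -/
theorem sum_lagged_expWeights_mul_le {B : ℕ} (hB : 0 < B) {η : ℝ} (hη : 0 < η) (hηB : η * B ≤ 1)
    {w : ℕ → M → ℝ} (hw0 : ∀ t c, 0 ≤ w t c) (hw1 : ∀ t c, w t c ≤ 1) (n : ℕ) (c₀ : M) :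
    ∑ t ∈ Finset.range n, ∑ c, expWeights η (lag B w t) c * w t c ≤
      ∑ t ∈ Finset.range n, w t c₀ + Real.log (Fintype.card M) / η + η * n + 2 * (η * B) * n := by
  have hB1 : (1 : ℝ) ≤ B := by exact_mod_cast hB
  have hη1 : η ≤ 1 := by nlinarith
  have hb0 : 0 ≤ η * B := by positivity
  have hexp : Real.exp (η * B) ≤ 1 + 2 * (η * B) := by
    have := (abs_le.1 (Real.abs_exp_sub_one_sub_id_le (x := η * B)
      (by rw [abs_of_nonneg hb0]; exact hηB))).2
    nlinarith
  have h1 : ∀ t, ∑ c, expWeights η (lag B w t) c * w t c ≤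
      ∑ c, expWeights η (fun c => ∑ s ∈ Finset.range t, w s c) c * w t c + 2 * (η * B) := by
    intro t
    have hfull : ∀ c, lag B w t c ≤ ∑ s ∈ Finset.range t, w s c ∧
        ∑ s ∈ Finset.range t, w s c ≤ lag B w t c + B := by
      intro c
      have h2 : ∑ s ∈ Finset.range t, w s c = lag B w t c +
          ∑ s ∈ Finset.range (t % B), w (B * (t / B) + s) c := by
        rw [lag, ← Finset.sum_range_add (fun s => w s c), Nat.div_add_mod]
      have h3 : 0 ≤ ∑ s ∈ Finset.range (t % B), w (B * (t / B) + s) c :=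
        Finset.sum_nonneg fun s _ => hw0 _ c
      have h4 : ∑ s ∈ Finset.range (t % B), w (B * (t / B) + s) c ≤ B := by
        calc _ ≤ ∑ _s ∈ Finset.range (t % B), (1 : ℝ) := Finset.sum_le_sum fun s _ => hw1 _ c
          _ = ((t % B : ℕ) : ℝ) := by simp
          _ ≤ B := by exact_mod_cast (Nat.mod_lt t hB).le
      constructor <;> linarith
    set Q := ∑ c, expWeights η (fun c => ∑ s ∈ Finset.range t, w s c) c * w t c with hQ
    have hQ1 : Q ≤ 1 := by
      rw [← sum_expWeights η (fun c => ∑ s ∈ Finset.range t, w s c)]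
      exact Finset.sum_le_sum fun c _ => mul_le_of_le_one_right (expWeights_pos _ _ c).le (hw1 t c)
    have hQ0 : 0 ≤ Q :=
      Finset.sum_nonneg fun c _ => mul_nonneg (expWeights_pos _ _ c).le (hw0 t c)
    calc _ ≤ ∑ c, Real.exp (η * B + 0) *
          expWeights η (fun c => ∑ s ∈ Finset.range t, w s c) c * w t c := by
          refine Finset.sum_le_sum fun c _ => mul_le_mul_of_nonneg_right ?_ (hw0 t c)
          refine expWeights_le (fun c => ?_) (fun c => ?_) c
          · have := mul_le_mul_of_nonneg_left (hfull c).2 hη.le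
            linarith
          · have := mul_le_mul_of_nonneg_left (hfull c).1 hη.le
            linarith
      _ = Real.exp (η * B) * Q := by
          rw [hQ, Finset.mul_sum, add_zero]
          exact Finset.sum_congr rfl fun c _ => mul_assoc _ _ _
      _ ≤ (1 + 2 * (η * B)) * Q := mul_le_mul_of_nonneg_right hexp hQ0
      _ ≤ _ := by nlinarith
  calc _ ≤ _ := Finset.sum_le_sum fun t _ => h1 t
    _ = ∑ t ∈ Finset.range n, ∑ c, expWeights η (fun c => ∑ s ∈ Finset.range t, w s c) c * w t c +
        2 * (η * B) * n := by
      rw [Finset.sum_add_distrib, Finset.sum_const, Finset.card_range, nsmul_eq_mul, mul_comm (n : ℝ)]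
    _ ≤ _ := add_le_add (sum_expWeights_mul_le hη hη1 hw0 hw1 n c₀) le_rfl

end regret

/-! ### Dynamic regret of the lazy algorithm -/

/-- The expert that a comparator plays in round `t`. -/
def comparatorPlay {N T S : ℕ} (d : Fin N) (t : ℕ) (c : Comparator N T S) : Fin N :=
  extend d c.1 t

theorem lazyAlgorithm_regret_le {N T S m B : ℕ} [Nonempty (Comparator N T S)] (hB : 0 < B)
    {η q : ℝ} (hη : 0 < η) (hq0 : 0 ≤ q) (hq1 : q ≤ 1) (hηB : η * B ≤ q / 4) (d : Fin N) :
    ((lazyAlgorithm m B hη.le hq0 hq1 d (comparatorPlay (T := T) (S := S) d)).toOnline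
      T).obliviousDynamicRegret S ≤
      Real.log (Fintype.card (Comparator N T S)) / η + η * T + 2 * (η * B) * T +
        T * (5 / 8) ^ m := by
  refine ciSup_le fun l => ?_
  set A := lazyAlgorithm m B hη.le hq0 hq1 d (comparatorPlay (T := T) (S := S) d) with hA
  set l' : ℕ → LossVector N := extend (fun _ => 0) l with hl'
  have hlt : ∀ t : Fin T, l' t = l t := fun t => extend_of_lt _ _ t.2
  have hlaw : ∀ J, (A.toOnline T).law (oblivious l) J = A.mass l' (extend d J) T := fun J =>
    A.law_toOnline _ J
  have hexp : ∑ J, (A.toOnline T).law (oblivious l) J * ∑ t : Fin T, (l t (J t) : ℝ) =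
      ∑ t : Fin T, seqExp A.init (A.op l') t (fun h => (l' t (A.vis t h) : ℝ)) := by
    simp only [Finset.mul_sum]
    rw [Finset.sum_comm]
    refine Finset.sum_congr rfl fun t _ => ?_
    rw [← sum_seqExp_mul_eq d A.vis (A.op_one l') T (fun a => (l' t a : ℝ)) t.2]
    refine Finset.sum_congr rfl fun J _ => ?_
    rw [hlaw, extend_of_lt _ _ t.2, hlt]
    rfl
  have hI : ∑ t : Fin T, seqExp A.init (A.op l') t (fun h => (l' t (A.vis t h) : ℝ)) -
      (Real.log (Fintype.card (Comparator N T S)) / η + η * T + 2 * (η * B) * T +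
        T * (5 / 8) ^ m) ≤
      ⨅ c : Comparator N T S, ∑ t : Fin T, (l t (c.1 t) : ℝ) := by
    refine le_ciInf fun c => ?_
    have h1 := sum_lagged_expWeights_mul_le hB hη (by linarith)
      (metaLoss_nonneg (comparatorPlay (T := T) (S := S) d) l')
      (metaLoss_le_one (comparatorPlay (T := T) (S := S) d) l') T c
    have h2 : ∑ t : Fin T, seqExp A.init (A.op l') t (fun h => (l' t (A.vis t h) : ℝ)) ≤
        ∑ t : Fin T, (∑ c, expWeights η (lag B (metaLoss (comparatorPlay (T := T) (S := S) d) l') t)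
          c * metaLoss (comparatorPlay (T := T) (S := S) d) l' t c + (5 / 8) ^ m) :=
      Finset.sum_le_sum fun t _ => seqExp_lazy_vis_le hη.le hq0 hq1 hηB d _ l' t
    rw [Finset.sum_add_distrib, Finset.sum_const, Finset.card_univ, Fintype.card_fin,
      nsmul_eq_mul] at h2
    rw [Finset.sum_range, Finset.sum_range] at h1
    have h3 : ∑ t : Fin T, metaLoss (comparatorPlay (T := T) (S := S) d) l' t c =
        ∑ t : Fin T, (l t (c.1 t) : ℝ) := by
      refine Finset.sum_congr rfl fun t _ => ?_
      rw [metaLoss, hlt, comparatorPlay, extend_of_lt _ _ t.2]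
    rw [h3] at h1
    linarith
  have hreg : (A.toOnline T).dynamicRegret (oblivious l) S =
      ∑ J, (A.toOnline T).law (oblivious l) J * ∑ t : Fin T, (l t (J t) : ℝ) -
        ⨅ c : Comparator N T S, ∑ t : Fin T, (l t (c.1 t) : ℝ) := by
    rw [OnlineAlgorithm.dynamicRegret, OnlineAlgorithm.expect]
    simp only [oblivious, mul_sub, Finset.sum_sub_distrib]
    congr 1
    rw [← Finset.sum_mul, OnlineAlgorithm.sum_law, one_mul]
  rw [hreg, hexp]
  linarith

/-! ### The number of comparators -/

/-- The graph of `c` at the first round and at the switches. -/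
def switchGraph {N T : ℕ} (c : Fin (T + 1) → Fin N) : Finset (Fin (T + 1) × Fin N) :=
  insert (0, c 0) ((Finset.univ.filter fun t : Fin T => c t.succ ≠ c t.castSucc).image
    fun t => (t.succ, c t.succ))

theorem card_switchGraph_le {N T : ℕ} (c : Fin (T + 1) → Fin N) :
    (switchGraph c).card ≤ switches c + 1 := by
  refine (Finset.card_insert_le _ _).trans (Nat.add_le_add_right (Finset.card_image_le.trans ?_) 1)
  rw [Finset.card_filter]
  exact le_rfl

theorem eq_of_mem_switchGraph {N T : ℕ} {c : Fin (T + 1) → Fin N} {x : Fin (T + 1) × Fin N}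
    (hx : x ∈ switchGraph c) : x.2 = c x.1 := by
  rw [switchGraph, Finset.mem_insert, Finset.mem_image] at hx
  rcases hx with rfl | ⟨t, -, rfl⟩ <;> rfl

/-- Between recorded points a sequence is constant, so induction on the round recovers it. If just
one sequence switched at `t.succ`, the other would still pass through the recorded point, since the
graphs are equal. -/
theorem switchGraph_injective {N T : ℕ} :
    Function.Injective (switchGraph : (Fin (T + 1) → Fin N) → Finset (Fin (T + 1) × Fin N)) := by
  intro c c' h
  have hmem : ∀ {c : Fin (T + 1) → Fin N} {t : Fin T}, c t.succ ≠ c t.castSucc →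
      (t.succ, c t.succ) ∈ switchGraph c := fun ht =>
    Finset.mem_insert_of_mem (Finset.mem_image.2
      ⟨_, Finset.mem_filter.2 ⟨Finset.mem_univ _, ht⟩, rfl⟩)
  ext1 t
  induction t using Fin.induction with
  | zero =>
    have h0 : (0, c 0) ∈ switchGraph c := Finset.mem_insert_self _ _
    rw [h] at h0
    exact eq_of_mem_switchGraph h0
  | succ t ih =>
    by_cases h1 : c t.succ = c t.castSucc
    · by_cases h2 : c' t.succ = c' t.castSucc
      · rw [h1, h2, ih]
      · have h3 := hmem h2
        rw [← h] at h3
        exact (eq_of_mem_switchGraph h3).symm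
    · have h3 := hmem h1
      rw [h] at h3
      exact eq_of_mem_switchGraph h3

/-- Listing a set with repetitions reduces counting sets of at most `k` points to counting functions
on `Fin k`. -/
theorem exists_image_eq {α : Type} [DecidableEq α] {D : Finset α} {k : ℕ} (hD : D.Nonempty)
    (hk : D.card ≤ k) : ∃ g : Fin k → α, Finset.univ.image g = D := by
  obtain ⟨x₀, hx₀⟩ := hD
  refine ⟨fun i => if h : (i : ℕ) < D.card then (D.equivFin.symm ⟨i, h⟩).1 else x₀, ?_⟩
  ext x
  simp only [Finset.mem_image, Finset.mem_univ, true_and]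
  constructor
  · rintro ⟨i, rfl⟩
    split_ifs
    · exact (D.equivFin.symm _).2
    · exact hx₀
  · intro hx
    refine ⟨⟨D.equivFin ⟨x, hx⟩, (D.equivFin ⟨x, hx⟩).2.trans_le hk⟩, ?_⟩
    simp

theorem card_comparator_le {N T S : ℕ} (hT : 1 ≤ T) :
    Fintype.card (Comparator N T S) ≤ (T * N) ^ (S + 1) := by
  obtain ⟨T, rfl⟩ := Nat.exists_eq_add_of_le' hT
  have h : ∀ c : Comparator N (T + 1) S, ∃ g : Fin (S + 1) → Fin (T + 1) × Fin N,
      Finset.univ.image g = switchGraph c.1 := fun c =>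
    exists_image_eq (Finset.insert_nonempty _ _)
      ((card_switchGraph_le c.1).trans (Nat.add_le_add_right c.2 1))
  choose g hg using h
  have hinj : Function.Injective g := fun c c' hc =>
    Subtype.ext (switchGraph_injective (by rw [← hg, ← hg, hc]))
  simpa using Fintype.card_le_of_injective g hinj

theorem nonempty_comparator {N T S : ℕ} (d : Fin N) : Nonempty (Comparator N T S) :=
  ⟨fun _ => d, by simp [switches]⟩

/-! ### Degenerate parameters -/

/-- The algorithm that always plays `d`. -/
noncomputable def constantAlgorithm {N : ℕ} (T : ℕ) (d : Fin N) : OnlineAlgorithm N T where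
  play _ _ _ := ⟨Pi.single d 1, single_mem_stdSimplex ℝ d⟩

theorem constantAlgorithm_isDP {N : ℕ} (T : ℕ) (d : Fin N) {ε δ : ℝ} (hε : 0 ≤ ε) (hδ : 0 ≤ δ) :
    (constantAlgorithm T d).IsDP ε δ := by
  intro Z adv z z' _ E
  have h1 : (constantAlgorithm T d).prob (adv.run z) E =
      (constantAlgorithm T d).prob (adv.run z') E := rfl
  have h2 : 0 ≤ (constantAlgorithm T d).prob (adv.run z') E :=
    Finset.sum_nonneg fun j _ => OnlineAlgorithm.law_nonneg _ _ j
  rw [h1]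
  have := Real.one_le_exp hε
  nlinarith

theorem obliviousDynamicRegret_le {N T : ℕ} (A : OnlineAlgorithm N T) (S : ℕ) :
    A.obliviousDynamicRegret S ≤ T :=
  ciSup_le fun l => A.dynamicRegret_le (oblivious l) S

theorem obliviousDynamicRegret_one {T : ℕ} (A : OnlineAlgorithm 1 T) (S : ℕ) :
    A.obliviousDynamicRegret S ≤ 0 := by
  refine ciSup_le fun l => le_of_eq ?_
  have : Nonempty (Comparator 1 T S) := nonempty_comparator 0
  rw [OnlineAlgorithm.dynamicRegret, OnlineAlgorithm.expect]
  refine Finset.sum_eq_zero fun J _ => ?_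
  have h : ∀ c : Comparator 1 T S, ∑ t : Fin T, (oblivious l t (past J t) (c.1 t) : ℝ) =
      ∑ t : Fin T, (oblivious l t (past J t) (J t) : ℝ) := fun c =>
    Finset.sum_congr rfl fun t _ => by rw [Subsingleton.elim (c.1 t) (J t)]
  simp only [h, ciInf_const, sub_self, mul_zero]

/-! ### The choice of the parameters -/

/-- Here `D` is the number of batches and `s` the rate of paid draws per slot and batch. The
hypothesis `hη3` is the constraint on `η` that forces the cube-root rate. -/
theorem block_exponent_le {T ε η Λ m n D s : ℝ} (hT : 0 ≤ T) (hε : 0 < ε) (hη : 0 ≤ η)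
    (hΛ : 1 ≤ Λ) (hm : 0 ≤ m) (hn : 0 ≤ n) (hD : D * s ≤ 3 * (T * η)) (hmΛ : m ≤ 4 * Λ)
    (hnΛ : n * ε ≤ 5 * Λ) (hη3 : T * η ^ 3 * (64000000 * Λ ^ 3) ≤ ε ^ 2) :
    D * (m * (s * (8 * n ^ 2 * η ^ 2))) ≤ n * ε / 4 := by
  have hTη : 0 ≤ T * η ^ 3 := by positivity
  have h1 : m * (n * ε) ≤ 20 * Λ ^ 3 :=
    calc m * (n * ε) ≤ 4 * Λ * (5 * Λ) := mul_le_mul hmΛ hnΛ (by positivity) (by linarith)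
      _ = 20 * Λ ^ 2 := by ring
      _ ≤ 20 * Λ ^ 3 :=
        mul_le_mul_of_nonneg_left (pow_le_pow_right₀ hΛ (by norm_num)) (by norm_num)
  have h2 : T * η ^ 3 * (m * (n * ε)) ≤ T * η ^ 3 * (20 * Λ ^ 3) :=
    mul_le_mul_of_nonneg_left h1 hTη
  have h3 : 24 * (T * η ^ 3 * (m * (n * ε))) ≤ ε ^ 2 / 4 := by
    have : 0 ≤ T * η ^ 3 * Λ ^ 3 := by positivity
    linarith
  refine le_of_mul_le_mul_right ?_ hε
  calc D * (m * (s * (8 * n ^ 2 * η ^ 2))) * ε = D * s * (m * (8 * n ^ 2 * η ^ 2) * ε) := by ring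
    _ ≤ 3 * (T * η) * (m * (8 * n ^ 2 * η ^ 2) * ε) :=
      mul_le_mul_of_nonneg_right hD (by positivity)
    _ = n * (24 * (T * η ^ 3 * (m * (n * ε)))) := by ring
    _ ≤ n * (ε ^ 2 / 4) := mul_le_mul_of_nonneg_left h3 hn
    _ = n * ε / 4 * ε := by ring

theorem mul_five_eighths_pow_le {T : ℝ} {m : ℕ} (hT : 0 < T) (hm : 3 * Real.log T ≤ m) :
    T * (5 / 8 : ℝ) ^ m ≤ 1 := by
  have h1 : (5 / 8 : ℝ) ≤ Real.exp (-(1 / 3)) := by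
    have h2 : Real.exp (1 / 3) ≤ 8 / 5 := by
      have h3 : Real.exp (1 / 3) ^ 3 = Real.exp 1 := by rw [← Real.exp_nat_mul]; norm_num
      have h4 := Real.exp_one_lt_d9
      refine le_of_pow_le_pow_left₀ (n := 3) (by norm_num) (by norm_num) ?_
      rw [h3]
      norm_num
      linarith
    rw [Real.exp_neg]
    calc (5 / 8 : ℝ) = (8 / 5)⁻¹ := by norm_num
      _ ≤ _ := inv_anti₀ (Real.exp_pos _) h2
  have h2 : (5 / 8 : ℝ) ^ m ≤ Real.exp (-Real.log T) := by
    calc _ ≤ Real.exp (-(1 / 3)) ^ m := pow_le_pow_left₀ (by norm_num) h1 m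
      _ = Real.exp (m * -(1 / 3)) := by rw [← Real.exp_nat_mul]
      _ ≤ _ := Real.exp_le_exp.2 (by linarith)
  rw [Real.exp_neg, Real.exp_log hT] at h2
  calc _ ≤ T * T⁻¹ := mul_le_mul_of_nonneg_left h2 hT.le
    _ = 1 := mul_inv_cancel₀ hT.ne'

theorem play_ratio_pow_le {η q ε : ℝ} {m : ℕ} (hη : 0 ≤ η) (hq : 0 < q)
    (h : 12 * m * η ≤ q * ε) :
    ((1 + 4 * η / q) * (1 + 2 * η / q)) ^ m ≤ Real.exp (ε / 2) := by
  have h1 := Real.add_one_le_exp (4 * η / q)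
  have h2 := Real.add_one_le_exp (2 * η / q)
  have h3 : (1 + 4 * η / q) * (1 + 2 * η / q) ≤ Real.exp (6 * η / q) := by
    calc _ ≤ Real.exp (4 * η / q) * Real.exp (2 * η / q) :=
          mul_le_mul (by linarith) (by linarith) (by positivity) (Real.exp_pos _).le
      _ = _ := by rw [← Real.exp_add]; ring_nf
  calc _ ≤ Real.exp (6 * η / q) ^ m := pow_le_pow_left₀ (by positivity) h3 m
    _ = Real.exp (m * (6 * η / q)) := (Real.exp_nat_mul _ _).symm
    _ ≤ Real.exp (ε / 2) := by
      refine Real.exp_le_exp.2 ?_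
      rw [mul_div_assoc', div_le_iff₀ hq]
      linarith

/-- Batching costs regret `η * B * T`, about `q * q * T` plus `η * T`; this bounds the first part by
`X`. -/
theorem mul_sq_le_of_cube_eq {T ε X q : ℝ} (hε : 0 < ε) (hX : 0 < X) (hX3 : X ^ 3 = T / ε ^ 2)
    (hq : 0 ≤ q) (h : q * X * ε ≤ 1) : q * q * T ≤ X := by
  have hT : T = X ^ 3 * ε ^ 2 := by rw [hX3]; field_simp
  calc q * q * T = (q * X * ε) ^ 2 * X := by rw [hT]; ring
    _ ≤ 1 * X := mul_le_mul_of_nonneg_right (pow_le_one₀ (by positivity) h) hX.le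
    _ = X := one_mul X

set_option maxHeartbeats 400000 in
/-- Feasible parameters. `X` is `T ^ (1 / 3) / ε ^ (2 / 3)`. -/
theorem exists_lazy_parameters {T : ℕ} {ε δ X η Λ : ℝ} (hT : 2 ≤ T) (hε : 0 < ε) (hε1 : ε < 1)
    (hδ : 0 < δ) (hδ1 : δ < 1) (hTε : 1 ≤ T * ε) (hX : 0 < X) (hX3 : X ^ 3 = T / ε ^ 2)
    (hΛ : Λ = Real.log (2 * (T / δ))) (hη : 0 < η) (hη1 : η * (400 * X * Λ) ≤ 1) :
    ∃ (m B n : ℕ) (q : ℝ), 0 < B ∧ 1 ≤ n ∧ 0 < q ∧ q ≤ 1 ∧ η * B ≤ q / 4 ∧ n * (2 * η) ≤ 1 ∧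
      ((1 + 4 * η / q) * (1 + 2 * η / q)) ^ m ≤ Real.exp (ε / 2) ∧
      Real.exp (ε / 2) * (Real.exp (-(n * (ε / 2))) * Real.exp ((T / B : ℕ) *
        (m * ((2 * (η * B) + q * q) * (8 * n ^ 2 * η ^ 2))))) ≤ δ ∧
      T * (5 / 8 : ℝ) ^ m ≤ 1 ∧ η * B * T ≤ η * T + X := by
  have hT0 : (0 : ℝ) < T := by positivity
  have hT2 : (2 : ℝ) ≤ T := by exact_mod_cast hT
  have hlog2 := Real.log_two_gt_d9
  have hΛ' : Λ = Real.log 2 + (Real.log T - Real.log δ) := by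
    rw [hΛ, Real.log_mul two_ne_zero (by positivity), Real.log_div hT0.ne' hδ.ne']
  have hlogT : Real.log 2 ≤ Real.log T := Real.log_le_log two_pos hT2
  have hlogδ : Real.log δ < 0 := Real.log_neg hδ hδ1
  -- The factor `2` in `Λ` yields `Λ ≥ 2 * log 2 > 1`, which lets the ceilings below be absorbed.
  have hΛ1 : 1 < Λ := by linarith
  have hXε : 1 ≤ X * ε := by
    by_contra hlt
    push Not at hlt
    have h1 : (X * ε) ^ 3 < 1 := pow_lt_one₀ (by positivity) hlt (by norm_num)
    have h2 : (X * ε) ^ 3 = T * ε := by rw [mul_pow, hX3]; field_simp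
    linarith
  have hηε : η * (400 * Λ) ≤ ε := by
    have h1 : η * (400 * Λ) * (X * ε) ≤ 1 * ε := by
      calc _ = η * (400 * X * Λ) * ε := by ring
        _ ≤ _ := mul_le_mul_of_nonneg_right hη1 hε.le
    have h2 : η * (400 * Λ) ≤ η * (400 * Λ) * (X * ε) := le_mul_of_one_le_right (by positivity) hXε
    linarith
  -- Enough slots that rounds without an active slot cost at most `1` in total.
  set m : ℕ := ⌈3 * Λ⌉₊ with hm
  have hm1 : 3 * Λ ≤ m := Nat.le_ceil _
  have hm2 : (m : ℝ) ≤ 4 * Λ := by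
    have := Nat.ceil_lt_add_one (show 0 ≤ 3 * Λ by linarith)
    linarith
  have hm0 : (0 : ℝ) < m := by linarith
  -- The smallest `q` for which `play_ratio_pow_le` yields `exp (ε / 2)`.
  set q : ℝ := 12 * m * η / ε with hq
  have hq0 : 0 < q := by positivity
  have hqε : q * ε = 12 * m * η := by rw [hq]; field_simp
  have hq8 : q ≤ 1 / 8 := by
    rw [hq, div_le_iff₀ hε]
    nlinarith
  have hηq : η ≤ q / 8 := by
    have : q * ε ≤ q := mul_le_of_le_one_right hq0.le hε1.le
    nlinarith
  -- This balances the two sources of fresh draws, emptying at rate `η * B` and replacement of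
  -- dormant slots at rate `q * q`.
  set B : ℕ := ⌈q * q / η⌉₊ with hB
  have hB0 : 0 < B := Nat.ceil_pos.2 (by positivity)
  have hBR : (0 : ℝ) < B := by exact_mod_cast hB0
  have hB1 : q * q ≤ η * B := by
    have := Nat.le_ceil (q * q / η)
    rw [div_le_iff₀ hη] at this
    linarith
  have hB2 : η * B ≤ q * q + η := by
    have h1 := (Nat.ceil_lt_add_one (show 0 ≤ q * q / η by positivity)).le
    have h2 := mul_le_mul_of_nonneg_left h1 hη.le
    rwa [mul_add, mul_div_cancel₀ _ hη.ne', mul_one] at h2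
  -- Markov's inequality gains `exp (-(n * ε / 2))` and the moment costs at most `exp (n * ε / 4)`;
  -- the remaining `exp (-Λ)` beats `δ` with room for `exp (ε / 2)`.
  set n : ℕ := ⌈4 * Λ / ε⌉₊ with hn
  have hn1 : 4 * Λ ≤ n * ε := by
    have := Nat.le_ceil (4 * Λ / ε)
    rwa [div_le_iff₀ hε] at this
  have hn2 : n * ε ≤ 5 * Λ := by
    have h1 := (Nat.ceil_lt_add_one (show 0 ≤ 4 * Λ / ε by positivity)).le
    have h2 := mul_le_mul_of_nonneg_right h1 hε.le
    rw [add_mul, div_mul_cancel₀ _ hε.ne', one_mul] at h2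
    linarith
  have hn0 : 0 < n := Nat.ceil_pos.2 (by positivity)
  refine ⟨m, B, n, q, hB0, hn0, hq0, by linarith, by nlinarith, ?_, ?_, ?_, ?_, ?_⟩
  · have h1 : n * (2 * η) * ε ≤ 1 * ε := by
      have := mul_le_mul_of_nonneg_right hn2 hη.le
      nlinarith
    exact le_of_mul_le_mul_right h1 hε
  · exact play_ratio_pow_le hη.le hq0 (by linarith)
  · rw [← Real.exp_add, ← Real.exp_add, ← Real.le_log_iff_exp_le hδ]
    have hη3 : T * η ^ 3 * (64000000 * Λ ^ 3) ≤ ε ^ 2 := by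
      have h1 : (η * (400 * X * Λ)) ^ 3 ≤ 1 := pow_le_one₀ (by positivity) hη1
      have h2 : (η * (400 * X * Λ)) ^ 3 = η ^ 3 * 64000000 * Λ ^ 3 * X ^ 3 := by ring
      rw [h2, hX3, mul_div_assoc', div_le_one (by positivity)] at h1
      linarith
    have hTB : ((T / B : ℕ) : ℝ) * (2 * (η * B) + q * q) ≤ 3 * (T * η) := by
      have h1 : ((T / B : ℕ) : ℝ) * B ≤ T := by exact_mod_cast Nat.div_mul_le_self T B
      have h2 : ((T / B : ℕ) : ℝ) * (2 * (η * B) + q * q) ≤ ((T / B : ℕ) : ℝ) * (3 * (η * B)) :=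
        mul_le_mul_of_nonneg_left (by linarith) (Nat.cast_nonneg _)
      nlinarith
    have hbig := block_exponent_le hT0.le hε hη.le hΛ1.le hm0.le (Nat.cast_nonneg n) hTB hm2 hn2 hη3
    linarith
  · exact mul_five_eighths_pow_le hT0 (by linarith)
  · have h1 : q * X * ε ≤ 1 := by
      have := mul_le_mul_of_nonneg_right (mul_le_mul_of_nonneg_right hm2 hη.le) hX.le
      linarith [mul_right_comm q X ε, congrArg (· * X) hqε]
    have h2 := mul_sq_le_of_cube_eq hε hX hX3 (by positivity) h1
    have := mul_le_mul_of_nonneg_right hB2 hT0.le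
    linarith

theorem exists_private_algorithm {ε δ X : ℝ} (hε : 0 < ε) (hε1 : ε < 1) (hδ : 0 < δ) (hδ1 : δ < 1)
    {T N S : ℕ} (hT : 2 ≤ T) (hN : 2 ≤ N) (hS : 1 ≤ S) (hTε : 1 ≤ T * ε) (hX : 0 < X)
    (hX3 : X ^ 3 = T / ε ^ 2) :
    ∃ A : OnlineAlgorithm N T, A.IsDP ε δ ∧ A.obliviousDynamicRegret S ≤
      2000 * (Real.sqrt (S * T * Real.log (N * T)) +
        S * X * Real.log (T / δ) * Real.log (N * T)) := by
  have hT2 : (2 : ℝ) ≤ T := by exact_mod_cast hT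
  have hN2 : (2 : ℝ) ≤ N := by exact_mod_cast hN
  have hS1 : (1 : ℝ) ≤ S := by exact_mod_cast hS
  have hT0 : (0 : ℝ) < T := by linarith
  have hlog2 := Real.log_two_gt_d9
  set K := Real.log (N * T) with hK
  have hK1 : 1 ≤ K := by
    have h1 : Real.log (2 * 2) ≤ K := Real.log_le_log (by norm_num) (by nlinarith)
    rw [Real.log_mul two_ne_zero two_ne_zero] at h1
    linarith
  set Y := Real.log (T / δ) with hY
  have hY2 : Real.log 2 ≤ Y := Real.log_le_log two_pos (by
    rw [le_div_iff₀ hδ]; nlinarith)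
  set Λ := Real.log (2 * (T / δ)) with hΛ
  have hΛY : Λ = Real.log 2 + Y := Real.log_mul two_ne_zero (by positivity)
  have hΛ1 : 1 < Λ := by linarith
  set R := Real.sqrt (S * T * K) with hR
  have hR2 : R ^ 2 = S * T * K := Real.sq_sqrt (by positivity)
  have hR1 : 1 ≤ R := by
    rw [hR, Real.one_le_sqrt]
    exact one_le_mul_of_one_le_of_one_le
      (one_le_mul_of_one_le_of_one_le hS1 (by linarith)) hK1
  set η := min (R / T) (1 / (400 * X * Λ)) with hη
  have hη0 : 0 < η := lt_min (by positivity) (by positivity)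
  have hη1 : η * (400 * X * Λ) ≤ 1 := by
    have := min_le_right (R / T) (1 / (400 * X * Λ))
    rwa [← hη, le_div_iff₀ (by positivity)] at this
  have hηT : η * T ≤ R := by
    have := min_le_left (R / T) (1 / (400 * X * Λ))
    rwa [← hη, le_div_iff₀ hT0] at this
  have hinv : 1 / η ≤ T / R + 400 * X * Λ := by
    rcases min_choice (R / T) (1 / (400 * X * Λ)) with h | h
    · rw [hη, h, one_div_div]
      linarith [show 0 ≤ 400 * X * Λ by positivity]
    · rw [hη, h, one_div_one_div]
      linarith [show 0 ≤ T / R by positivity]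
  obtain ⟨m, B, n, q, hB, hn, hq0, hq1, hηB, hnη, hp1, hp2, hm, hBT⟩ :=
    exists_lazy_parameters hT hε hε1 hδ hδ1 hTε hX hX3 hΛ hη0 hη1
  have d : Fin N := ⟨0, by omega⟩
  have hne : Nonempty (Comparator N T S) := nonempty_comparator d
  refine ⟨(lazyAlgorithm m B hη0.le hq0.le hq1 d (comparatorPlay (T := T) (S := S) d)).toOnline T,
    lazyAlgorithm_isDP hB hn hη0.le hq0 hq1 (by linarith) hnη hp1 hp2 d _, ?_⟩
  refine (lazyAlgorithm_regret_le hB hη0 hq0.le hq1 hηB d).trans ?_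
  have hcard : Real.log (Fintype.card (Comparator N T S)) ≤ 2 * S * K := by
    have h1 : (Fintype.card (Comparator N T S) : ℝ) ≤ ((T : ℝ) * N) ^ (S + 1) := by
      exact_mod_cast card_comparator_le (N := N) (S := S) (by omega : 1 ≤ T)
    have h2 := Real.log_le_log (by exact_mod_cast Fintype.card_pos) h1
    rw [Real.log_pow, mul_comm (T : ℝ) N, ← hK] at h2
    push_cast at h2
    nlinarith
  have h1 : Real.log (Fintype.card (Comparator N T S)) / η ≤
      2 * R + 800 * (S * X * K * Λ) := by
    -- By `R ^ 2 = S * T * K`.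
    have h2 : 2 * S * K * (T / R) = 2 * R := by
      field_simp
      linarith
    calc _ = Real.log (Fintype.card (Comparator N T S)) * (1 / η) := by ring
      _ ≤ 2 * S * K * (1 / η) := mul_le_mul_of_nonneg_right hcard (by positivity)
      _ ≤ 2 * S * K * (T / R + 400 * X * Λ) := mul_le_mul_of_nonneg_left hinv (by positivity)
      _ = 2 * S * K * (T / R) + 800 * (S * X * K * Λ) := by ring
      _ = _ := by rw [h2]
  have h3 : X ≤ S * X * K * Λ := by
    calc X = 1 * X * 1 * 1 := by ring
      _ ≤ S * X * K * Λ := by gcongr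
  have h4 : S * X * K * Λ ≤ S * X * K * (2 * Y) :=
    mul_le_mul_of_nonneg_left (by linarith) (by positivity)
  have h5 : S * X * Y * K = S * X * K * Y := by ring
  have h6 : 0 ≤ S * X * K * Y := by
    have : 0 ≤ Y := by linarith
    positivity
  rw [h5]
  linarith

end PrivateExperts

/-! ### Main theorem -/

theorem mainTheorem3 :
    ∃ C : ℝ, 0 < C ∧
      ∀ (ε δ : ℝ), 0 < ε → ε < 1 → 0 < δ → δ < 1 →
      ∀ (T N S : ℕ), 1 ≤ T → 1 ≤ N → 1 ≤ S →
        ∃ B : PrivateExperts.OnlineAlgorithm N T,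
          B.IsDP ε δ ∧
          B.obliviousDynamicRegret S ≤
            C * (Real.sqrt ((S : ℝ) * T * Real.log ((N : ℝ) * T)) +
              (S : ℝ) * (T : ℝ) ^ (1 / 3 : ℝ) * Real.log ((T : ℝ) / δ) *
                Real.log ((N : ℝ) * T) / ε ^ (2 / 3 : ℝ)) := by
  refine ⟨2000, by norm_num, fun ε δ hε hε1 hδ hδ1 T N S hT hN hS => ?_⟩
  have hT1 : (1 : ℝ) ≤ T := by exact_mod_cast hT
  have hN1 : (1 : ℝ) ≤ N := by exact_mod_cast hN
  have hS1 : (1 : ℝ) ≤ S := by exact_mod_cast hS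
  have hT0 : (0 : ℝ) < T := by linarith
  have hlog2 := Real.log_two_gt_d9
  set X : ℝ := (T : ℝ) ^ (1 / 3 : ℝ) / ε ^ (2 / 3 : ℝ) with hX
  have hX0 : 0 < X := by positivity
  have hX3 : X ^ 3 = T / ε ^ 2 := by
    rw [hX, div_pow, ← Real.rpow_mul_natCast hT0.le, ← Real.rpow_mul_natCast hε.le]
    norm_num
  have hform : (S : ℝ) * (T : ℝ) ^ (1 / 3 : ℝ) * Real.log ((T : ℝ) / δ) *
      Real.log ((N : ℝ) * T) / ε ^ (2 / 3 : ℝ) =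
        S * X * Real.log (T / δ) * Real.log (N * T) := by
    rw [hX]; ring
  rw [hform]
  have hK0 : 0 ≤ Real.log ((N : ℝ) * T) := Real.log_nonneg (by nlinarith)
  have hY0 : 0 ≤ Real.log ((T : ℝ) / δ) := Real.log_nonneg (by rw [le_div_iff₀ hδ]; linarith)
  have hterm : 0 ≤ S * X * Real.log (T / δ) * Real.log (N * T) := by positivity
  have hsqrt := Real.sqrt_nonneg ((S : ℝ) * T * Real.log ((N : ℝ) * T))
  -- With one expert the regret vanishes; this case is separate because `log (N * T)` may be `0`.
  by_cases hN' : N = 1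
  · subst hN'
    exact ⟨PrivateExperts.constantAlgorithm T 0,
      PrivateExperts.constantAlgorithm_isDP T 0 hε.le hδ.le,
      (PrivateExperts.obliviousDynamicRegret_one _ S).trans
        (mul_nonneg (by norm_num) (add_nonneg hsqrt hterm))⟩
  have hN2 : 2 ≤ N := by omega
  have hN2' : (2 : ℝ) ≤ N := by exact_mod_cast hN2
  have hK : Real.log 2 ≤ Real.log ((N : ℝ) * T) := Real.log_le_log two_pos (by nlinarith)
  by_cases hmain : 2 ≤ T ∧ 1 ≤ T * ε
  · exact PrivateExperts.exists_private_algorithm hε hε1 hδ hδ1 hmain.1 hN2 hS hmain.2 hX0 hX3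
  refine ⟨PrivateExperts.constantAlgorithm T ⟨0, by omega⟩,
    PrivateExperts.constantAlgorithm_isDP T _ hε.le hδ.le,
    (PrivateExperts.obliviousDynamicRegret_le _ S).trans ?_⟩
  by_cases hT' : T = 1
  · have h1 : (1 / 2 : ℝ) ≤ Real.sqrt ((S : ℝ) * T * Real.log ((N : ℝ) * T)) := by
      refine Real.le_sqrt_of_sq_le ?_
      calc (1 / 2 : ℝ) ^ 2 ≤ 1 * 1 * Real.log ((N : ℝ) * T) := by linarith
        _ ≤ _ := by gcongr
    have h2 : (T : ℝ) = 1 := by exact_mod_cast hT'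
    linarith
  · have hT2 : 2 ≤ T := by omega
    have hT2' : (2 : ℝ) ≤ T := by exact_mod_cast hT2
    have hTε : T * ε < 1 := by
      by_contra h
      exact hmain ⟨hT2, not_lt.1 h⟩
    have hY : Real.log 2 ≤ Real.log ((T : ℝ) / δ) := Real.log_le_log two_pos (by
      rw [le_div_iff₀ hδ]; nlinarith)
    -- If `T * ε < 1`, the second term of the bound already exceeds the trivial regret `T` up to a
    -- constant, so a constant algorithm suffices.
    have hTX : (T : ℝ) ≤ X := by
      refine le_of_pow_le_pow_left₀ (n := 3) (by norm_num) hX0.le ?_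
      rw [hX3, le_div_iff₀ (by positivity)]
      calc (T : ℝ) ^ 3 * ε ^ 2 = ((T : ℝ) * ε) ^ 2 * (T : ℝ) := by ring
        _ ≤ 1 * (T : ℝ) := mul_le_mul_of_nonneg_right (pow_le_one₀ (by positivity) hTε.le) hT0.le
        _ = (T : ℝ) := one_mul _
    have h1 : 1 * X * (1 / 2) * (1 / 2) ≤ S * X * Real.log (T / δ) * Real.log (N * T) := by
      gcongr <;> linarith
    linarith
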